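/- A colored stochastic dataset in $\mathbb{R}^2$ is a triple $\mathcal{S}=(S,\mathrm{cl},\pi)$, where $S\subset\mathbb{R}^2$ is a finite set of $n$ points, $\mathrm{cl}:S\to\mathbb{N}$ assigns a color to every point, and $\pi:S\to[0,1]$ assigns an existence probability to every point. A realization of $\mathcal{S}$ is a random subset $R\subseteq S$ that contains each $a\in S$ independently with probability $\pi(a)$. A point $p$ dominates another point $q$ if each coordinate of $p$ is at least the corresponding coordinate of $q$. A subset $A\subseteq S$ contains inter-color dominances if there are $a,b\in A$ with $\mathrm{cl}(a)\neq\mathrm{cl}(b)$ such that $a$ dominates $b$. The colored stochastic dominance (CSD) problem asks for the probability $\Lambda_{\mathcal{S}}$ that a realization of $\mathcal{S}$ contains inter-color dominances. **Theorem.** The CSD problem in $\mathbb{R}^2$ can be solved in $O(n^2\log^2 n)$ time on a real RAM. That is, there is a single real-RAM program that, given the number $n$ of points and the coordinates, colors and existence probabilities of the points of an arbitrary colored stochastic dataset $\mathcal{S}$ in $\mathbb{R}^2$, listed in arbitrary order, halts with output exactly $\Lambda_{\mathcal{S}}$ after at most $T(n)$ unit-cost steps, where $T(n)=O(n^2\log^2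 n)$. Here a real RAM is a random access machine whose memory cells hold natural numbers or real numbers, whose unit-cost operations are indirect memory access, addition, subtraction and comparison of natural numbers, and exact addition, subtraction, multiplication, division and comparison of real numbers, and whose programs may contain only integer and rational constants. -/

import Mathlib

/-! ## Colored stochastic datasets and the probability to be computed -/

namespace ColoredDominance

/-- `p` dominates another point `q`: every coordinate of `p` is at least that of `q`. -/
def Dominates {d : ℕ} (p q : Fin d → ℝ) : Prop :=
  p ≠ q ∧ ∀ i, q i ≤ p i

/-- A colored stochastic dataset `(S, cl, π)` in `ℝ^d`: a finite point set, a coloring, and an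
existence probability for every point. -/
structure Dataset (d : ℕ) where
  points : Finset (Fin d → ℝ)
  color : points → ℕ
  prob : points → ℝ
  prob_mem : ∀ a, prob a ∈ Set.Icc (0 : ℝ) 1

/-- `A ⊆ S` contains an inter-color dominance. -/
def Dataset.HasInterColorDominance {d : ℕ} (S : Dataset d) (A : Finset S.points) : Prop :=
  ∃ a ∈ A, ∃ b ∈ A, S.color a ≠ S.color b ∧ Dominates a.1 b.1

/-- The probability that the realization of `S` is exactly `A`, every point `a` being sampled
independently with probability `π a`. -/
noncomputable def Dataset.realizationProb {d : ℕ} (S : Dataset d) (A : Finset S.points) : ℝ :=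
  (∏ a ∈ A, S.prob a) * ∏ a ∈ Finset.univ \ A, (1 - S.prob a)

open Classical in
/-- `Λ_S`: the probability that a realization of `S` contains inter-color dominances. -/
noncomputable def Dataset.dominanceProb {d : ℕ} (S : Dataset d) : ℝ :=
  ∑ A : Finset S.points with S.HasInterColorDominance A, S.realizationProb A

end ColoredDominance

/-! ## A real RAM

A uniform-cost random access machine with exact real arithmetic, programmed in a structured
language.  A program refers by fixed names to finitely many scalar variables and arrays, whose
entries are natural numbers (integer side) or real numbers (real side); array indices are computed
natural numbers.  On the integer side there are only constants, addition, subtraction and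
comparison (no multiplication, division or bit operations); on the real side there are rational
constants, the four field operations and comparison (no rounding, and no conversion between reals
and integers).  Each operation, constant, variable access, array access, test and assignment
costs one step. -/

namespace RealRAM

/-- The memory: scalar variables and arrays of natural numbers and of reals, by name. -/
structure State where
  ivar : ℕ → ℕ
  rvar : ℕ → ℝ
  iarr : ℕ → ℕ → ℕ
  rarr : ℕ → ℕ → ℝ

/-- Integer expressions. -/
inductive IExpr where
  | const (c : ℕ)
  | var (v : ℕ)
  | read (a : ℕ) (idx : IExpr)
  | add (e₁ e₂ : IExpr)
  | sub (e₁ e₂ : IExpr)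

/-- Value of an integer expression (subtraction is truncated at `0`). -/
def IExpr.eval (σ : State) : IExpr → ℕ
  | const c => c
  | var v => σ.ivar v
  | read a idx => σ.iarr a (idx.eval σ)
  | add e₁ e₂ => e₁.eval σ + e₂.eval σ
  | sub e₁ e₂ => e₁.eval σ - e₂.eval σ

/-- Number of elementary operations in an integer expression. -/
def IExpr.cost : IExpr → ℕ
  | const _ => 1
  | var _ => 1
  | read _ idx => idx.cost + 1
  | add e₁ e₂ => e₁.cost + e₂.cost + 1
  | sub e₁ e₂ => e₁.cost + e₂.cost + 1

/-- Real expressions. -/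
inductive RExpr where
  | const (c : ℚ)
  | var (v : ℕ)
  | read (a : ℕ) (idx : IExpr)
  | add (e₁ e₂ : RExpr)
  | sub (e₁ e₂ : RExpr)
  | mul (e₁ e₂ : RExpr)
  | div (e₁ e₂ : RExpr)

/-- Value of a real expression (a division by `0` returns `0`). -/
noncomputable def RExpr.eval (σ : State) : RExpr → ℝ
  | const c => (c : ℝ)
  | var v => σ.rvar v
  | read a idx => σ.rarr a (idx.eval σ)
  | add e₁ e₂ => e₁.eval σ + e₂.eval σ
  | sub e₁ e₂ => e₁.eval σ - e₂.eval σ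
  | mul e₁ e₂ => e₁.eval σ * e₂.eval σ
  | div e₁ e₂ => e₁.eval σ / e₂.eval σ

/-- Number of elementary operations in a real expression. -/
def RExpr.cost : RExpr → ℕ
  | const _ => 1
  | var _ => 1
  | read _ idx => idx.cost + 1
  | add e₁ e₂ => e₁.cost + e₂.cost + 1
  | sub e₁ e₂ => e₁.cost + e₂.cost + 1
  | mul e₁ e₂ => e₁.cost + e₂.cost + 1
  | div e₁ e₂ => e₁.cost + e₂.cost + 1

/-- Tests: comparisons of two integers or of two reals. -/
inductive Test where
  | ilt (e₁ e₂ : IExpr)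
  | ieq (e₁ e₂ : IExpr)
  | rlt (e₁ e₂ : RExpr)
  | req (e₁ e₂ : RExpr)

/-- The test succeeds in the state `σ`. -/
def Test.Holds (σ : State) : Test → Prop
  | ilt e₁ e₂ => e₁.eval σ < e₂.eval σ
  | ieq e₁ e₂ => e₁.eval σ = e₂.eval σ
  | rlt e₁ e₂ => e₁.eval σ < e₂.eval σ
  | req e₁ e₂ => e₁.eval σ = e₂.eval σ

/-- Number of elementary operations in a test. -/
def Test.cost : Test → ℕ
  | ilt e₁ e₂ => e₁.cost + e₂.cost + 1
  | ieq e₁ e₂ => e₁.cost + e₂.cost + 1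
  | rlt e₁ e₂ => e₁.cost + e₂.cost + 1
  | req e₁ e₂ => e₁.cost + e₂.cost + 1

/-- Programs. -/
inductive Program where
  | skip
  | iset (v : ℕ) (e : IExpr)
  | rset (v : ℕ) (e : RExpr)
  | iwrite (a : ℕ) (idx : IExpr) (e : IExpr)
  | rwrite (a : ℕ) (idx : IExpr) (e : RExpr)
  | seq (P Q : Program)
  | branch (b : Test) (P Q : Program)
  | loop (b : Test) (P : Program)

/-- `Runs P σ t σ'`: the program `P`, started in `σ`, halts after exactly `t` steps in `σ'`. -/
inductive Runs : Program → State → ℕ → State → Prop where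
  | skip (σ : State) : Runs .skip σ 1 σ
  | iset (v : ℕ) (e : IExpr) (σ : State) :
      Runs (.iset v e) σ (e.cost + 1)
        { σ with ivar := Function.update σ.ivar v (e.eval σ) }
  | rset (v : ℕ) (e : RExpr) (σ : State) :
      Runs (.rset v e) σ (e.cost + 1)
        { σ with rvar := Function.update σ.rvar v (e.eval σ) }
  | iwrite (a : ℕ) (idx e : IExpr) (σ : State) :
      Runs (.iwrite a idx e) σ (idx.cost + e.cost + 1)
        { σ with iarr := Function.update σ.iarr a
                    (Function.update (σ.iarr a) (idx.eval σ) (e.eval σ)) }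
  | rwrite (a : ℕ) (idx : IExpr) (e : RExpr) (σ : State) :
      Runs (.rwrite a idx e) σ (idx.cost + e.cost + 1)
        { σ with rarr := Function.update σ.rarr a
                    (Function.update (σ.rarr a) (idx.eval σ) (e.eval σ)) }
  | seq {P Q : Program} {σ σ₁ σ₂ : State} {t₁ t₂ : ℕ} :
      Runs P σ t₁ σ₁ → Runs Q σ₁ t₂ σ₂ → Runs (.seq P Q) σ (t₁ + t₂) σ₂
  | branch_true {b : Test} {P Q : Program} {σ σ' : State} {t : ℕ} :
      b.Holds σ → Runs P σ t σ' → Runs (.branch b P Q) σ (b.cost + t) σ'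
  | branch_false {b : Test} {P Q : Program} {σ σ' : State} {t : ℕ} :
      ¬ b.Holds σ → Runs Q σ t σ' → Runs (.branch b P Q) σ (b.cost + t) σ'
  | loop_true {b : Test} {P : Program} {σ σ₁ σ₂ : State} {t₁ t₂ : ℕ} :
      b.Holds σ → Runs P σ t₁ σ₁ → Runs (.loop b P) σ₁ t₂ σ₂ →
        Runs (.loop b P) σ (b.cost + t₁ + t₂) σ₂
  | loop_false {b : Test} {P : Program} {σ : State} :
      ¬ b.Holds σ → Runs (.loop b P) σ b.cost σ

end RealRAM

namespace ColoredDominance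

/-- The initial memory for a planar dataset whose points are listed, in an arbitrary order, as
`a_0, …, a_{n-1}`: integer variable `0` holds `n`, integer array `0` holds the colors, the real
arrays `0`, `1`, `2` hold the `x`-coordinates, the `y`-coordinates and the existence probabilities,
and everything else is `0`. -/
noncomputable def Dataset.inputState (S : Dataset 2) {n : ℕ} (a : Fin n ≃ S.points) :
    RealRAM.State where
  ivar v := if v = 0 then n else 0
  rvar _ := 0
  iarr k i := if h : i < n then (if k = 0 then S.color (a ⟨i, h⟩) else 0) else 0
  rarr k i :=
    if h : i < n then
      (if k = 0 then (a ⟨i, h⟩).1 0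
       else if k = 1 then (a ⟨i, h⟩).1 1
       else if k = 2 then S.prob (a ⟨i, h⟩)
       else 0)
    else 0

/-- The program `P` solves the colored stochastic dominance problem in the plane within `T n` steps
on `n` points: on every dataset `S` of `n` points, listed in any order, it halts after at most
`T n` steps with `Λ_S` in real variable `0`. -/
def SolvesPlanarCSD (P : RealRAM.Program) (T : ℕ → ℕ) : Prop :=
  ∀ (S : Dataset 2) (n : ℕ) (a : Fin n ≃ S.points),
    ∃ (t : ℕ) (σ : RealRAM.State), t ≤ T n ∧ RealRAM.Runs P (S.inputState a) t σ ∧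
      σ.rvar 0 = S.dominanceProb

end ColoredDominance

/-! Sort the points lexicographically and replace heights by ranks `r`, ties broken by sorted index.
A point `q` then dominates `p` iff `p < q` and `r p ≤ r q`, so a set is free of inter-color
dominances iff its indices are `Legal`. When a sampled set is scanned in this order, the past
restricts the future only through the lowest point `m` so far and the height `b` of the lowest point
before the current run of the color of `m`: a new point of that color must lie below `b`, any other
point below `m`. A dummy point `0`, of a color of its own and above everything, serves as start.
`accept` is the resulting recursion; `accept_eq_sum` and `acceptAfter_eq_one_sub` identify its value
at the start with `1 - Λ`.

There are quadratically many states `(b, m)`, so each must be evaluated in logarithmic time. For a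
fixed state, every later point acts on the acceptance probability by an affine map: the linear part
belongs to keeping the state, the translation to moving to a state with lowest point `q`. Hence the
value sought is a product of affine maps evaluated at `1` (`accept_eq_seg`). Moves within the color
of `m` lead to `(b, q)`, moves to another color to `(r m, q)`, and linearity splits the value into a
same-color part and `leave` (`acceptAfter_eq`). Both are suffix products in a segment tree, where
passing to the next state changes at most one leaf: for fixed `b` and rising `m`, the leaves are
ordered by color and the points of other colors in between are condensed into the number `gap`, so
that one tree serves all colors (`seg_grouped`); for fixed `m` and rising `b`, only the point of
height `b` changes its factor.

Stage `a` computes row `b = a` from the columns of the points lower than `a`, then the column of the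
point of height `a` from that row. This makes a linear number of tree operations per stage, `O(n²
log n)` steps in all, which is within the required bound; preprocessing by counting predecessors is
quadratic. Programs are verified through `Halts`, with loop invariants and syntactic frames. -/

namespace ColoredDominance

/-! ### Ordered products of affine maps -/

/-- The affine map `x ↦ p * x + s`. -/
@[ext] structure Aff where
  p : ℝ
  s : ℝ

namespace Aff

/-- Composition, with `g` applied first. For any product, `s` is the value at `0` and `s + p` the
value at `1`. -/
instance : Mul Aff := ⟨fun f g => ⟨f.p * g.p, f.s + f.p * g.s⟩⟩
instance : One Aff := ⟨⟨1, 0⟩⟩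

@[simp] theorem mul_p (f g : Aff) : (f * g).p = f.p * g.p := rfl
@[simp] theorem mul_s (f g : Aff) : (f * g).s = f.s + f.p * g.s := rfl
@[simp] theorem one_p : (1 : Aff).p = 1 := rfl
@[simp] theorem one_s : (1 : Aff).s = 0 := rfl

instance : Monoid Aff where
  mul_assoc f g h := by ext <;> simp <;> ring
  one_mul f := by ext <;> simp
  mul_one f := by ext <;> simp

end Aff

/-- The ordered product `f a * f (a + 1) * ⋯ * f (b - 1)`. -/
noncomputable def seg (f : ℕ → Aff) (a b : ℕ) : Aff :=
  ((List.range' a (b - a)).map f).prod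

theorem seg_of_le (f : ℕ → Aff) {a b : ℕ} (h : b ≤ a) : seg f a b = 1 := by
  simp [seg, Nat.sub_eq_zero_of_le h]

theorem seg_cons (f : ℕ → Aff) {a b : ℕ} (h : a < b) : seg f a b = f a * seg f (a + 1) b := by
  have h1 : b - a = (b - (a + 1)) + 1 := by omega
  simp [seg, h1, List.range'_succ]

theorem seg_congr {f g : ℕ → Aff} {a b : ℕ} (h : ∀ i, a ≤ i → i < b → f i = g i) :
    seg f a b = seg g a b := by
  induction hd : b - a generalizing a with
  | zero => rw [seg_of_le _ (by omega), seg_of_le _ (by omega)]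
  | succ d ih =>
    rw [seg_cons f (by omega), seg_cons g (by omega), h a le_rfl (by omega),
      ih (fun i h1 h2 => h i (by omega) h2) (by omega)]

theorem seg_append (f : ℕ → Aff) {a b c : ℕ} (h1 : a ≤ b) (h2 : b ≤ c) :
    seg f a b * seg f b c = seg f a c := by
  induction hd : b - a generalizing a with
  | zero => obtain rfl : a = b := by omega
            rw [seg_of_le _ le_rfl, one_mul]
  | succ d ih =>
    rw [seg_cons f (by omega : a < b), seg_cons f (by omega : a < c), mul_assoc,
      ih (by omega) (by omega)]

/-- The nodes `2 * a, …, 2 * b - 1` are the children of `a, …, b - 1` in order, so moving up one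
level of the tree preserves the product. -/
theorem seg_double {f : ℕ → Aff} {a b : ℕ}
    (h : ∀ v, a ≤ v → v < b → f v = f (2 * v) * f (2 * v + 1)) :
    seg f (2 * a) (2 * b) = seg f a b := by
  induction hd : b - a generalizing a with
  | zero => rw [seg_of_le _ (by omega), seg_of_le _ (by omega)]
  | succ d ih =>
    rw [seg_cons f (by omega : 2 * a < 2 * b), seg_cons f (by omega : 2 * a + 1 < 2 * b),
      seg_cons f (by omega : a < b), h a le_rfl (by omega), mul_assoc,
      ← ih (fun i h1 h2 => h i (by omega) h2) (by omega)]
    rfl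

theorem seg_shift (f : ℕ → Aff) (N a b : ℕ) :
    seg f (N + a) (N + b) = seg (fun i => f (N + i)) a b := by
  induction hd : b - a generalizing a with
  | zero => rw [seg_of_le _ (by omega), seg_of_le _ (by omega)]
  | succ d ih =>
    rw [seg_cons f (by omega), seg_cons _ (by omega : a < b), add_assoc, ih _ (by omega)]

theorem seg_s_eq_zero {f : ℕ → Aff} {a b : ℕ} (h : ∀ i, a ≤ i → i < b → (f i).s = 0) :
    (seg f a b).s = 0 := by
  induction hd : b - a generalizing a with
  | zero => rw [seg_of_le _ (by omega), Aff.one_s]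
  | succ d ih =>
    rw [seg_cons f (by omega), Aff.mul_s, h a le_rfl (by omega),
      ih (fun i h1 h2 => h i (by omega) h2) (by omega)]
    simp

theorem seg_p_congr {f g : ℕ → Aff} {a b : ℕ} (h : ∀ i, a ≤ i → i < b → (f i).p = (g i).p) :
    (seg f a b).p = (seg g a b).p := by
  induction hd : b - a generalizing a with
  | zero => rw [seg_of_le _ (by omega), seg_of_le _ (by omega)]
  | succ d ih =>
    rw [seg_cons f (by omega), seg_cons g (by omega), Aff.mul_p, Aff.mul_p, h a le_rfl (by omega),
      ih (fun i h1 h2 => h i (by omega) h2) (by omega)]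

/-- For fixed linear parts the value at `0` is linear in the translations. This separates same-color
moves from the others. -/
theorem seg_s_add (p s t : ℕ → ℝ) (a b : ℕ) :
    (seg (fun i => ⟨p i, s i + t i⟩) a b).s =
      (seg (fun i => ⟨p i, s i⟩) a b).s + (seg (fun i => ⟨p i, t i⟩) a b).s := by
  induction hd : b - a generalizing a with
  | zero => simp [seg_of_le _ (by omega : b ≤ a)]
  | succ d ih =>
    simp only [seg_cons _ (by omega : a < b), Aff.mul_s, ih (a + 1) (by omega)]
    ring

/-! ### Ranks -/

/-- The number of indices below `K` that precede `q`. -/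
def rank (K : ℕ) (lt : ℕ → ℕ → Prop) [DecidableRel lt] (q : ℕ) : ℕ :=
  ((Finset.range K).filter fun j => lt j q).card

section rank

variable {K : ℕ} {lt : ℕ → ℕ → Prop} [DecidableRel lt]

theorem rank_lt (irr : ∀ i, ¬ lt i i) {q : ℕ} (hq : q < K) : rank K lt q < K := by
  have : (Finset.range K).filter (fun j => lt j q) ⊂ Finset.range K := by
    rw [Finset.filter_ssubset]
    exact ⟨q, by simpa using hq, irr q⟩
  simpa [rank] using Finset.card_lt_card this

theorem rank_lt_rank (irr : ∀ i, ¬ lt i i) (tr : ∀ i j k, lt i j → lt j k → lt i k)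
    {i j : ℕ} (hi : i < K) (h : lt i j) : rank K lt i < rank K lt j := by
  apply Finset.card_lt_card
  rw [Finset.ssubset_iff_of_subset]
  · exact ⟨i, by simpa using ⟨hi, h⟩, by simp [irr]⟩
  · intro k
    simp only [Finset.mem_filter]
    exact fun ⟨h1, h2⟩ => ⟨h1, tr _ _ _ h2 h⟩

theorem rank_lt_rank_iff (irr : ∀ i, ¬ lt i i) (tr : ∀ i j k, lt i j → lt j k → lt i k)
    (tot : ∀ i j, i < K → j < K → i ≠ j → lt i j ∨ lt j i) {i j : ℕ} (hi : i < K) (hj : j < K) :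
    rank K lt i < rank K lt j ↔ lt i j := by
  refine ⟨fun h => ?_, rank_lt_rank irr tr hi⟩
  rcases eq_or_ne i j with rfl | hne
  · omega
  · rcases tot i j hi hj hne with h' | h'
    · exact h'
    · have := rank_lt_rank irr tr hj h'
      omega

theorem rank_inj (irr : ∀ i, ¬ lt i i) (tr : ∀ i j k, lt i j → lt j k → lt i k)
    (tot : ∀ i j, i < K → j < K → i ≠ j → lt i j ∨ lt j i) {i j : ℕ} (hi : i < K) (hj : j < K)
    (h : rank K lt i = rank K lt j) : i = j := by
  by_contra hne
  rcases tot i j hi hj hne with h' | h'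
  · have := rank_lt_rank irr tr hi h'
    omega
  · have := rank_lt_rank irr tr hj h'
    omega

theorem exists_rank_eq (irr : ∀ i, ¬ lt i i) (tr : ∀ i j k, lt i j → lt j k → lt i k)
    (tot : ∀ i j, i < K → j < K → i ≠ j → lt i j ∨ lt j i) {k : ℕ} (hk : k < K) :
    ∃ i < K, rank K lt i = k := by
  have := Finset.surj_on_of_inj_on_of_card_le (s := Finset.range K) (t := Finset.range K)
    (fun i _ => rank K lt i) (fun i hi => by simpa using rank_lt irr (by simpa using hi))
    (fun i j hi hj h => rank_inj irr tr tot (by simpa using hi) (by simpa using hj) h) le_rfl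
    k (by simpa using hk)
  obtain ⟨i, hi, h⟩ := this
  exact ⟨i, by simpa using hi, h.symm⟩

end rank

/-! ### Grouping the factors of one color -/

/-- The product of `α` over the indices below `q` after the last one of color `c`, and `0` if there
is none of color `c`. -/
noncomputable def gap (α : ℕ → ℝ) (col : ℕ → ℕ) (c : ℕ) : ℕ → ℝ
  | 0 => 0
  | j + 1 => if col j = c then 1 else gap α col c j * α j

theorem gap_eq_zero {α : ℕ → ℝ} {col : ℕ → ℕ} {c q : ℕ} (h : ∀ j < q, col j ≠ c) :
    gap α col c q = 0 := by
  induction q with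
  | zero => rfl
  | succ q ih => simp [gap, h q (by omega), ih fun j hj => h j (by omega)]

/-- Between consecutive points of one color all factors are pure scalings, so they condense to one
scalar. -/
theorem seg_eq_gap {α : ℕ → ℝ} {col : ℕ → ℕ} {g : ℕ → Aff} {m q : ℕ} (hmq : m < q)
    (h : ∀ j, m < j → j < q → col j ≠ col m ∧ g j = ⟨α j, 0⟩) :
    seg g (m + 1) q = ⟨gap α col (col m) q, 0⟩ := by
  induction q, hmq using Nat.le_induction with
  | base => rw [seg_of_le _ le_rfl]; simp [gap]; rfl
  | succ q hq ih =>
    have hq' := h q hq (by omega)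
    rw [← seg_append g hq (Nat.le_succ q), ih fun j h1 h2 => h j h1 (by omega),
      seg_cons _ (Nat.lt_succ_self q), seg_of_le _ le_rfl, hq'.2]
    ext <;> simp [gap, hq'.1]

/-- Sorted by color, then index, the later points of the color of `m` occupy the positions right
after `cp m`. Each leaf carries its factor preceded by the gap in front of it, which rebuilds the
original product. The first point of the next color has gap `0`; its leaf is the zero map and cuts
off everything behind it. The linear parts are not preserved by this, so only translations are
compared. -/
theorem seg_grouped {K N : ℕ} (hKN : K ≤ N) {α : ℕ → ℝ} {col cp : ℕ → ℕ} {F lf : ℕ → Aff}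
    (hcp : ∀ q < K, cp q < K) (hsurj : ∀ i < K, ∃ q < K, cp q = i)
    (hlt : ∀ q < K, ∀ q' < K, cp q < cp q' ↔ col q < col q' ∨ (col q = col q' ∧ q < q'))
    (hlf : ∀ q < K, lf (cp q) =
      ⟨gap α col (col q) q * (F q).p, gap α col (col q) q * (F q).s⟩)
    (hpad : ∀ i, K ≤ i → i < N → (lf i).s = 0) {m : ℕ} (hm : m < K) :
    (seg lf (cp m + 1) N).s =
      (seg (fun q => if col q = col m then F q else ⟨α q, 0⟩) (m + 1) K).s := by
  induction hd : K - cp m using Nat.strong_induction_on generalizing m with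
  | _ d ih =>
  have hcm := hcp m hm
  by_cases hex : ∃ q, m < q ∧ q < K ∧ col q = col m
  · classical
    obtain ⟨hmq, hqK, hcol⟩ := Nat.find_spec hex
    have hmin : ∀ j, m < j → j < Nat.find hex → col j ≠ col m := fun j h1 h2 h3 =>
      Nat.find_min hex h2 ⟨h1, by omega, h3⟩
    set q := Nat.find hex
    have h1 : cp m < cp q := (hlt m hm q hqK).2 (Or.inr ⟨hcol.symm, hmq⟩)
    have hcq := hcp q hqK
    -- A point placed strictly between would have the same color and an index between `m` and `q`,
    -- against the choice of `q`.
    have h2 : cp q = cp m + 1 := by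
      by_contra hne
      obtain ⟨j, hj, hjc⟩ := hsurj (cp m + 1) (by omega)
      have h3 := (hlt m hm j hj).1 (by omega)
      have h4 := (hlt j hj q hqK).1 (by omega)
      have h5 := hmin j
      omega
    have h3 := ih (K - cp q) (by omega) hqK rfl
    rw [seg_cons lf (by omega : cp m + 1 < N), ← h2, hlf q hqK, Aff.mul_s, h3,
      ← seg_append _ (by omega : m + 1 ≤ q) hqK.le, seg_cons _ hqK,
      seg_eq_gap (α := α) (col := col) hmq
        (fun j h1 h2 => ⟨hmin j h1 h2, by simp [hmin j h1 h2]⟩)]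
    simp only [hcol, if_true, Aff.mul_s]
    ring
  · push Not at hex
    rw [seg_s_eq_zero (a := m + 1) (b := K)
      (fun i h1 h2 => by simp [hex i (by omega) h2])]
    by_cases hK : cp m + 1 < K
    · obtain ⟨j, hj, hjc⟩ := hsurj (cp m + 1) hK
      have h3 := (hlt m hm j hj).1 (by omega)
      have h4 : col m < col j := by
        rcases h3 with h3 | h3
        · exact h3
        · exact absurd h3.1.symm (hex j h3.2 hj)
      -- An earlier point of this color would have a position strictly between `cp m` and `cp m +
      -- 1`. So `j` is first of its color and its gap is `0`.
      have h5 : ∀ i < j, col i ≠ col j := fun i hi hc => by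
        have h6 := (hlt m hm i (by omega)).2 (Or.inl (by omega))
        have h7 := (hlt i (by omega) j hj).2 (Or.inr ⟨hc, hi⟩)
        omega
      rw [seg_cons lf (by omega : cp m + 1 < N), ← hjc, hlf j hj, gap_eq_zero h5]
      simp
    · exact seg_s_eq_zero fun i h1 h2 => hpad i (by omega) h2

/-! ### The acceptance probabilities -/

section automaton

variable (α : ℕ → ℝ) (col r : ℕ → ℕ)

/-- The probability that the points listed may still be sampled without creating an inter-color
dominance, if `m` is the lowest point sampled so far and `b` is the height of the lowest one before
the current run of points of the color of `m`; a point `q` is absent with probability `α q`. -/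
noncomputable def accept : List ℕ → ℕ → ℕ → ℝ
  | [], _, _ => 1
  | q :: l, b, m => α q * accept l b m + (1 - α q) *
      (if col q = col m then
        (if r q < b then (if r q < r m then accept l b q else accept l b m) else 0)
      else (if r q < r m then accept l (r m) q else 0))

/-- Acceptance probability of the points after `m` and before `K`. -/
noncomputable def acceptAfter (K b m : ℕ) : ℝ :=
  accept α col r (List.range' (m + 1) (K - (m + 1))) b m

/-- The factor with which the point `q` acts on the acceptance probability of state `(b, m)`. -/
noncomputable def stay (b m q : ℕ) : ℝ :=
  if col q = col m ∧ r m ≤ r q ∧ r q < b then 1 else α q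

/-- Contribution of the points `q` of the color of `m`. -/
noncomputable def moveSame (K b m q : ℕ) : ℝ :=
  if col q = col m ∧ r q < r m then (1 - α q) * acceptAfter α col r K b q else 0

/-- Contribution of the points `q` of another color than `m`. -/
noncomputable def moveOther (K m q : ℕ) : ℝ :=
  if col q ≠ col m ∧ r q < r m then (1 - α q) * acceptAfter α col r K (r m) q else 0

/-- The part of `acceptAfter K b m` in which the run of `m` is left or never lowered. -/
noncomputable def leave (K b m : ℕ) : ℝ :=
  (seg (fun q => ⟨stay α col r b m q, moveOther α col r K m q⟩) (m + 1) K).s +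
    (seg (fun q => ⟨stay α col r b m q, moveOther α col r K m q⟩) (m + 1) K).p

/-- The state is kept if `q` is absent, and also if `q` is present with the color of `m` at a height
in `[r m, b)`; this is `stay`. Otherwise a present point either moves the state or is rejected. The
empty list accepts with probability `1`, whence the evaluation at `1`. -/
theorem accept_eq_seg (K b m : ℕ) (hb : r m < b) (t : ℕ) :
    accept α col r (List.range' t (K - t)) b m =
      (seg (fun q => ⟨stay α col r b m q, moveSame α col r K b m q + moveOther α col r K m q⟩)
        t K).s +
      (seg (fun q => ⟨stay α col r b m q, moveSame α col r K b m q + moveOther α col r K m q⟩)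
        t K).p := by
  induction hd : K - t generalizing t with
  | zero => simp [seg_of_le _ (by omega : K ≤ t), accept]
  | succ d ih =>
    have hd' : d = K - (t + 1) := by omega
    have ih := ih (t + 1) hd'.symm
    rw [List.range'_succ, seg_cons _ (by omega), accept, Aff.mul_s, Aff.mul_p, ih]
    have e : ∀ b', accept α col r (List.range' (t + 1) d) b' t = acceptAfter α col r K b' t :=
      fun b' => by rw [acceptAfter, hd']
    rw [e, e]
    unfold stay moveSame moveOther
    by_cases h1 : col t = col m <;> by_cases h2 : r t < r m <;> by_cases h3 : r t < b <;>
      first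
      | omega
      | (simp [h1, h2, h3, not_lt.1]; done)
      | (have h4 : r m ≤ r t := by omega
         simp [h1, h2, h3, h4]; try ring)
      | (have h4 : ¬ r m ≤ r t := by omega
         simp [h1, h2, h3, h4]; try ring)

/-- The first term refers only to states of the same row `b`. The second refers to row `r m` and
depends on `b` through `stay` alone. This makes two separate sweeps possible. -/
theorem acceptAfter_eq (K b m : ℕ) (hb : r m < b) :
    acceptAfter α col r K b m =
      (seg (fun q => ⟨stay α col r b m q, moveSame α col r K b m q⟩) (m + 1) K).s +
        leave α col r K b m := by
  rw [acceptAfter, accept_eq_seg α col r K b m hb, seg_s_add, leave, add_assoc]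
  congr 2
  exact seg_p_congr fun _ _ _ => rfl

end automaton

/-! ### Acceptance as a sum over legal subsets -/

section acceptance

variable (α : ℕ → ℝ) (col r : ℕ → ℕ)

/-- The indices in `B` contain no inter-color dominance. -/
def Legal (B : Finset ℕ) : Prop :=
  ∀ p ∈ B, ∀ q ∈ B, p < q → r p ≤ r q → col p = col q

/-- The indices in `B` may follow in the state `(b, m)`. -/
def Follows (b m : ℕ) (B : Finset ℕ) : Prop :=
  Legal col r B ∧ ∀ q ∈ B, (col q = col m → r q < b) ∧ (col q ≠ col m → r q < r m)

/-- The probability that exactly the indices in `B` are sampled from `s`. -/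
noncomputable def weight (s B : Finset ℕ) : ℝ :=
  (∏ q ∈ B, (1 - α q)) * ∏ q ∈ s \ B, α q

/-- Since `q` precedes `B`, legality adds only that points of `B` of a color other than that of `q`
lie below `q`. Combined with the old bounds this is the condition of the next state. When the color
changes, `hb` makes the old bound `b` redundant. -/
theorem follows_insert {b m q : ℕ} {B : Finset ℕ} (hb : r m < b) (hq : ∀ p ∈ B, q < p) :
    Follows col r b m (insert q B) ↔
      if col q = col m then
        (if r q < b then (if r q < r m then Follows col r b q B else Follows col r b m B) else False)
      else (if r q < r m then Follows col r (r m) q B else False) := by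
  have key : Follows col r b m (insert q B) ↔ Legal col r B ∧
      ((col q = col m → r q < b) ∧ (col q ≠ col m → r q < r m)) ∧
      ∀ p ∈ B, (r q ≤ r p → col q = col p) ∧
        (col p = col m → r p < b) ∧ (col p ≠ col m → r p < r m) := by
    constructor
    · rintro ⟨h1, h2⟩
      refine ⟨fun p hp p' hp' => h1 p (by simp [hp]) p' (by simp [hp']), h2 q (by simp),
        fun p hp => ⟨fun h => h1 q (by simp) p (by simp [hp]) (hq p hp) h, h2 p (by simp [hp])⟩⟩
    · rintro ⟨h1, h2, h3⟩
      refine ⟨fun p hp p' hp' hlt hr => ?_, fun p hp => ?_⟩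
      · rw [Finset.mem_insert] at hp hp'
        rcases hp with rfl | hp <;> rcases hp' with rfl | hp'
        · rfl
        · exact (h3 p' hp').1 hr
        · have := hq p hp
          omega
        · exact h1 p hp p' hp' hlt hr
      · rw [Finset.mem_insert] at hp
        rcases hp with rfl | hp
        · exact h2
        · exact (h3 p hp).2
  rw [key]
  unfold Follows
  split_ifs with h1 h2 h3 h3
  · refine and_congr_right fun _ => ⟨fun h p hp => ?_, fun h => ⟨by omega, fun p hp => ?_⟩⟩
    · have := h.2 p hp
      omega
    · have := h p hp
      omega
  · refine and_congr_right fun _ => ⟨fun h p hp => ?_, fun h => ⟨by omega, fun p hp => ?_⟩⟩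
    · have := h.2 p hp
      omega
    · have := h p hp
      omega
  · simp only [iff_false]
    intro h
    exact h2 (h.2.1.1 h1)
  · refine and_congr_right fun _ => ⟨fun h p hp => ?_, fun h => ⟨by omega, fun p hp => ?_⟩⟩
    · have := h.2 p hp
      omega
    · have := h p hp
      omega
  · simp only [iff_false]
    intro h
    exact h3 (h.2.1.2 h1)

-- Splitting the subsets by membership of the first index `t` reproduces the recursion of `accept`,
-- with `follows_insert` identifying the next state. Every state reached again satisfies `r m < b`.
open Classical in
theorem accept_eq_sum (K t b m : ℕ) (hb : r m < b) :
    accept α col r (List.range' t (K - t)) b m =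
      ∑ B ∈ (Finset.Ico t K).powerset,
        if Follows col r b m B then weight α (Finset.Ico t K) B else 0 := by
  induction hd : K - t generalizing t b m with
  | zero =>
    have : Finset.Ico t K = ∅ := Finset.Ico_eq_empty (by omega)
    simp [this, accept, Follows, Legal, weight]
  | succ d ih =>
    have ih := fun b m hb => ih (t + 1) b m hb (by omega)
    have hI : Finset.Ico t K = insert t (Finset.Ico (t + 1) K) := by
      ext; simp; omega
    have ht : t ∉ Finset.Ico (t + 1) K := by simp
    rw [hI, Finset.sum_powerset_insert ht, List.range'_succ, accept, ih b m hb]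
    congr 1
    · rw [Finset.mul_sum]
      refine Finset.sum_congr rfl fun B hB => ?_
      have hB' : t ∉ B := fun h => ht (Finset.mem_powerset.1 hB h)
      rw [mul_ite, mul_zero]
      congr 1
      rw [weight, weight, Finset.insert_sdiff_of_notMem _ hB', Finset.prod_insert (by simp)]
      ring
    · have e : ∀ B ∈ (Finset.Ico (t + 1) K).powerset,
          weight α (insert t (Finset.Ico (t + 1) K)) (insert t B) =
            (1 - α t) * weight α (Finset.Ico (t + 1) K) B := fun B hB => by
        have hB' : t ∉ B := fun h => ht (Finset.mem_powerset.1 hB h)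
        rw [weight, weight, Finset.prod_insert hB', Finset.insert_sdiff_insert,
          Finset.sdiff_insert_of_notMem ht]
        ring
      have e' : ∀ B ∈ (Finset.Ico (t + 1) K).powerset, ∀ p ∈ B, t < p := fun B hB p hp => by
        have := Finset.mem_Ico.1 (Finset.mem_powerset.1 hB hp)
        omega
      have e'' : ∀ B ∈ (Finset.Ico (t + 1) K).powerset,
          (if Follows col r b m (insert t B) then
            weight α (insert t (Finset.Ico (t + 1) K)) (insert t B) else 0) =
          (1 - α t) * if (if col t = col m then
            (if r t < b then (if r t < r m then Follows col r b t B else Follows col r b m B)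
              else False)
            else (if r t < r m then Follows col r (r m) t B else False)) then
              weight α (Finset.Ico (t + 1) K) B else 0 := fun B hB => by
        rw [e B hB, mul_ite_zero]
        exact if_congr (follows_insert col r hb (e' B hB)) rfl rfl
      rw [Finset.sum_congr rfl e'', ← Finset.mul_sum]
      congr 1
      by_cases h1 : col t = col m
      · by_cases h2 : r t < b
        · by_cases h3 : r t < r m
          · simpa only [h1, h2, h3, if_true] using ih b t h2
          · simp only [h1, h2, h3, if_true, if_false]
        · simp [h1, h2]
      · by_cases h3 : r t < r m
        · simpa only [h1, h3, if_true, if_false] using ih (r m) t h3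
        · simp [h1, h3]

end acceptance

/-! ### The dominance probability as an acceptance probability -/

theorem sum_realizationProb {d : ℕ} (S : Dataset d) :
    ∑ A : Finset S.points, S.realizationProb A = 1 := by
  have := Finset.prod_add (fun a => S.prob a) (fun a => 1 - S.prob a) Finset.univ
  rw [Finset.powerset_univ] at this
  rw [← Finset.prod_eq_one (s := Finset.univ) (f := fun a => S.prob a + (1 - S.prob a))
    (by simp), this]
  rfl

/-- The dummy `0` shares its color with no point and lies above all of them, so the state `(n + 1,
0)` imposes nothing beyond legality. By `hdom`, legality is the absence of inter-color dominances.
-/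
theorem acceptAfter_eq_one_sub {d n : ℕ} (S : Dataset d) (α : ℕ → ℝ) (col r : ℕ → ℕ)
    (σ : S.points ↪ ℕ) (hσ : Finset.univ.map σ = Finset.Ico 1 (n + 1))
    (hα : ∀ x, α (σ x) = 1 - S.prob x) (hcol : ∀ x, col (σ x) = S.color x + 1)
    (h0 : col 0 = 0) (hr0 : r 0 = n) (hr : ∀ q, 1 ≤ q → q ≤ n → r q < n)
    (hdom : ∀ x y : S.points, Dominates x.1 y.1 ↔ σ y < σ x ∧ r (σ y) ≤ r (σ x)) :
    acceptAfter α col r (n + 1) (n + 1) 0 = 1 - S.dominanceProb := by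
  classical
  have hsub : 1 - S.dominanceProb =
      ∑ A : Finset S.points, if S.HasInterColorDominance A then 0 else S.realizationProb A := by
    rw [← sum_realizationProb S, Dataset.dominanceProb, Finset.sum_filter,
      ← Finset.sum_sub_distrib]
    refine Finset.sum_congr rfl fun A _ => ?_
    split_ifs <;> simp
  rw [acceptAfter, accept_eq_sum α col r _ _ _ _ (by omega), hsub, zero_add]
  symm
  refine Finset.sum_bij (fun A _ => A.map σ) ?_ ?_ ?_ ?_
  · intro A _
    rw [Finset.mem_powerset, ← hσ]
    exact Finset.map_subset_map.2 (Finset.subset_univ A)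
  · intro A _ B _ h
    exact Finset.map_injective σ h
  · intro B hB
    rw [Finset.mem_powerset, ← hσ, Finset.subset_map_iff] at hB
    obtain ⟨A, -, rfl⟩ := hB
    exact ⟨A, Finset.mem_univ A, rfl⟩
  · intro A _
    have hf : Follows col r (n + 1) 0 (A.map σ) ↔ ¬ S.HasInterColorDominance A := by
      have h1 : Follows col r (n + 1) 0 (A.map σ) ↔ Legal col r (A.map σ) := by
        refine and_iff_left fun q hq => ?_
        obtain ⟨x, -, rfl⟩ := Finset.mem_map.1 hq
        have : σ x ∈ Finset.univ.map σ := by simp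
        rw [hσ, Finset.mem_Ico] at this
        have := hr (σ x) this.1 (by omega)
        have := hcol x
        omega
      rw [h1]
      constructor
      · rintro h ⟨a, ha, b, hb, hc, hd⟩
        have h2 := (hdom a b).1 hd
        have := h (σ b) (by simpa using hb) (σ a) (by simpa using ha) h2.1 h2.2
        rw [hcol, hcol] at this
        omega
      · intro h p hp q hq h1 h2
        obtain ⟨x, hx, rfl⟩ := Finset.mem_map.1 hp
        obtain ⟨y, hy, rfl⟩ := Finset.mem_map.1 hq
        by_contra hne
        refine h ⟨y, hy, x, hx, fun hc => hne ?_, (hdom y x).2 ⟨h1, h2⟩⟩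
        rw [hcol, hcol, hc]
    by_cases h : S.HasInterColorDominance A
    · rw [if_pos h, if_neg (by rw [hf]; exact not_not.2 h)]
    · rw [if_neg h, if_pos (hf.2 h), weight, ← hσ, ← Finset.map_sdiff, Finset.prod_map,
        Finset.prod_map, Dataset.realizationProb]
      simp [hα]

end ColoredDominance

namespace RealRAM

infixr:60 " ;; " => Program.seq

/-! ### Total correctness with a time bound -/

/-- `P`, started in `σ`, halts within `T` steps in a state satisfying `Q`. -/
def Halts (P : Program) (σ : State) (T : ℕ) (Q : State → Prop) : Prop :=
  ∃ t σ', t ≤ T ∧ Runs P σ t σ' ∧ Q σ'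

theorem Halts.mono {P : Program} {σ : State} {T T' : ℕ} {Q Q' : State → Prop}
    (h : Halts P σ T Q) (hT : T ≤ T') (hQ : ∀ σ', Q σ' → Q' σ') : Halts P σ T' Q' := by
  obtain ⟨t, σ', h1, h2, h3⟩ := h
  exact ⟨t, σ', h1.trans hT, h2, hQ _ h3⟩

theorem Halts.seq {P P' : Program} {σ : State} {T T' T'' : ℕ} {Q R : State → Prop}
    (h : Halts P σ T Q) (h' : ∀ σ', Q σ' → Halts P' σ' T' R) (hT : T + T' ≤ T'') :
    Halts (P ;; P') σ T'' R := by
  obtain ⟨t, σ', h1, h2, h3⟩ := h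
  obtain ⟨t', σ'', h1', h2', h3'⟩ := h' σ' h3
  exact ⟨t + t', σ'', by omega, h2.seq h2', h3'⟩

open Classical in
/-- The final state of a program without loops. -/
noncomputable def Program.exec : Program → State → State
  | .skip, σ => σ
  | .iset v e, σ => { σ with ivar := Function.update σ.ivar v (e.eval σ) }
  | .rset v e, σ => { σ with rvar := Function.update σ.rvar v (e.eval σ) }
  | .iwrite a idx e, σ =>
      { σ with iarr := Function.update σ.iarr a
                  (Function.update (σ.iarr a) (idx.eval σ) (e.eval σ)) }
  | .rwrite a idx e, σ =>
      { σ with rarr := Function.update σ.rarr a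
                  (Function.update (σ.rarr a) (idx.eval σ) (e.eval σ)) }
  | .seq P Q, σ => Q.exec (P.exec σ)
  | .branch b P Q, σ => if b.Holds σ then P.exec σ else Q.exec σ
  | .loop _ _, σ => σ

/-- A bound on the running time of a program without loops. -/
def Program.cost : Program → ℕ
  | .skip => 1
  | .iset _ e => e.cost + 1
  | .rset _ e => e.cost + 1
  | .iwrite _ idx e => idx.cost + e.cost + 1
  | .rwrite _ idx e => idx.cost + e.cost + 1
  | .seq P Q => P.cost + Q.cost
  | .branch b P Q => b.cost + max P.cost Q.cost
  | .loop _ _ => 0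

/-- The program contains no loops. -/
def Program.loopFree : Program → Bool
  | .seq P Q => P.loopFree && Q.loopFree
  | .branch _ P Q => P.loopFree && Q.loopFree
  | .loop _ _ => false
  | _ => true

/-- Loop-free code is run symbolically, its final state being a term that `simp` can evaluate. The
values of `exec` and `cost` at loops are junk, excluded by `loopFree`. -/
theorem Program.runs_exec {P : Program} (hP : P.loopFree = true) (σ : State) :
    ∃ t ≤ P.cost, Runs P σ t (P.exec σ) := by
  induction P generalizing σ with
  | skip => exact ⟨_, le_rfl, .skip σ⟩
  | iset v e => exact ⟨_, le_rfl, .iset v e σ⟩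
  | rset v e => exact ⟨_, le_rfl, .rset v e σ⟩
  | iwrite a idx e => exact ⟨_, le_rfl, .iwrite a idx e σ⟩
  | rwrite a idx e => exact ⟨_, le_rfl, .rwrite a idx e σ⟩
  | seq P Q ihP ihQ =>
    simp only [loopFree, Bool.and_eq_true] at hP
    obtain ⟨t, ht, h⟩ := ihP hP.1 σ
    obtain ⟨t', ht', h'⟩ := ihQ hP.2 (P.exec σ)
    exact ⟨t + t', by simp only [cost]; omega, h.seq h'⟩
  | branch b P Q ihP ihQ =>
    simp only [loopFree, Bool.and_eq_true] at hP
    by_cases hb : b.Holds σ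
    · obtain ⟨t, ht, h⟩ := ihP hP.1 σ
      refine ⟨b.cost + t, by simp only [cost]; omega, ?_⟩
      rw [exec, if_pos hb]
      exact .branch_true hb h
    · obtain ⟨t, ht, h⟩ := ihQ hP.2 σ
      refine ⟨b.cost + t, by simp only [cost]; omega, ?_⟩
      rw [exec, if_neg hb]
      exact .branch_false hb h
  | loop b P => simp [loopFree] at hP

theorem Halts.exec {P : Program} {σ : State} {T : ℕ} {Q : State → Prop}
    (hP : P.loopFree = true) (hT : P.cost ≤ T) (hQ : Q (P.exec σ)) : Halts P σ T Q := by
  obtain ⟨t, ht, h⟩ := Program.runs_exec hP σ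
  exact ⟨t, _, ht.trans hT, h, hQ⟩

theorem Halts.branch {b : Test} {P P' : Program} {σ : State} {T T' : ℕ} {Q : State → Prop}
    (h : b.Holds σ → Halts P σ T Q) (h' : ¬ b.Holds σ → Halts P' σ T Q) (hT : b.cost + T ≤ T') :
    Halts (.branch b P P') σ T' Q := by
  by_cases hb : b.Holds σ
  · obtain ⟨t, σ', h1, h2, h3⟩ := h hb
    exact ⟨_, σ', by omega, .branch_true hb h2, h3⟩
  · obtain ⟨t, σ', h1, h2, h3⟩ := h' hb
    exact ⟨_, σ', by omega, .branch_false hb h2, h3⟩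

/-- The index `j` is fuel: it bounds the remaining iterations and drops by one in each. The loop may
stop with fuel left over. -/
theorem Halts.whileLoop {b : Test} {P : Program} {T c : ℕ} (I : ℕ → State → Prop)
    (hc : b.cost ≤ c)
    (step : ∀ j σ, I j σ → b.Holds σ → ∃ i, j = i + 1 ∧ Halts P σ T (I i))
    {j : ℕ} {σ : State} (h : I j σ) :
    Halts (.loop b P) σ (j * (T + c) + c) (fun σ' => ∃ i, I i σ' ∧ ¬ b.Holds σ') := by
  induction j generalizing σ with
  | zero =>
    by_cases hb : b.Holds σ
    · obtain ⟨i, hi, -⟩ := step _ _ h hb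
      omega
    · exact ⟨_, σ, by omega, .loop_false hb, 0, h, hb⟩
  | succ j ih =>
    by_cases hb : b.Holds σ
    · obtain ⟨i, hi, t, σ', ht, hr, hI⟩ := step _ _ h hb
      obtain rfl : j = i := by omega
      obtain ⟨t', σ'', ht', hr', hQ⟩ := ih hI
      refine ⟨_, σ'', ?_, .loop_true hb hr hr', hQ⟩
      rw [Nat.succ_mul]
      omega
    · refine ⟨_, σ, ?_, .loop_false hb, _, h, hb⟩
      rw [Nat.succ_mul]
      omega

/-! ### Frames -/

/-- The integer variables a program may change. -/
def Program.ivars : Program → List ℕ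
  | .iset v _ => [v]
  | .seq P Q => P.ivars ++ Q.ivars
  | .branch _ P Q => P.ivars ++ Q.ivars
  | .loop _ P => P.ivars
  | _ => []

/-- The real variables a program may change. -/
def Program.rvars : Program → List ℕ
  | .rset v _ => [v]
  | .seq P Q => P.rvars ++ Q.rvars
  | .branch _ P Q => P.rvars ++ Q.rvars
  | .loop _ P => P.rvars
  | _ => []

/-- The integer arrays a program may change. -/
def Program.iarrs : Program → List ℕ
  | .iwrite a _ _ => [a]
  | .seq P Q => P.iarrs ++ Q.iarrs
  | .branch _ P Q => P.iarrs ++ Q.iarrs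
  | .loop _ P => P.iarrs
  | _ => []

/-- The real arrays a program may change. -/
def Program.rarrs : Program → List ℕ
  | .rwrite a _ _ => [a]
  | .seq P Q => P.rarrs ++ Q.rarrs
  | .branch _ P Q => P.rarrs ++ Q.rarrs
  | .loop _ P => P.rarrs
  | _ => []

/-- The states agree on everything that `P` does not change. -/
structure Frame (P : Program) (σ σ' : State) : Prop where
  ivar : ∀ v, v ∉ P.ivars → σ'.ivar v = σ.ivar v
  rvar : ∀ v, v ∉ P.rvars → σ'.rvar v = σ.rvar v
  iarr : ∀ v, v ∉ P.iarrs → σ'.iarr v = σ.iarr v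
  rarr : ∀ v, v ∉ P.rarrs → σ'.rarr v = σ.rarr v

/-- The assigned names are read off the syntax, so later claims that memory is preserved reduce to
`decide`. -/
theorem Runs.frame {P : Program} {σ σ' : State} {t : ℕ} (h : Runs P σ t σ') : Frame P σ σ' := by
  induction h with
  | skip => exact ⟨fun _ _ => rfl, fun _ _ => rfl, fun _ _ => rfl, fun _ _ => rfl⟩
  | iset v e σ =>
    exact ⟨fun w hw => Function.update_of_ne (by simpa [Program.ivars] using hw) _ _,
      fun _ _ => rfl, fun _ _ => rfl, fun _ _ => rfl⟩
  | rset v e σ =>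
    exact ⟨fun _ _ => rfl,
      fun w hw => Function.update_of_ne (by simpa [Program.rvars] using hw) _ _,
      fun _ _ => rfl, fun _ _ => rfl⟩
  | iwrite a idx e σ =>
    exact ⟨fun _ _ => rfl, fun _ _ => rfl,
      fun w hw => Function.update_of_ne (by simpa [Program.iarrs] using hw) _ _, fun _ _ => rfl⟩
  | rwrite a idx e σ =>
    exact ⟨fun _ _ => rfl, fun _ _ => rfl, fun _ _ => rfl,
      fun w hw => Function.update_of_ne (by simpa [Program.rarrs] using hw) _ _⟩
  | seq _ _ ih ih' =>
    constructor <;> intro v hv <;>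
      simp only [Program.ivars, Program.rvars, Program.iarrs, Program.rarrs, List.mem_append,
        not_or] at hv
    · rw [ih'.ivar v hv.2, ih.ivar v hv.1]
    · rw [ih'.rvar v hv.2, ih.rvar v hv.1]
    · rw [ih'.iarr v hv.2, ih.iarr v hv.1]
    · rw [ih'.rarr v hv.2, ih.rarr v hv.1]
  | branch_true _ _ ih =>
    constructor <;> intro v hv <;>
      simp only [Program.ivars, Program.rvars, Program.iarrs, Program.rarrs, List.mem_append,
        not_or] at hv
    · rw [ih.ivar v hv.1]
    · rw [ih.rvar v hv.1]
    · rw [ih.iarr v hv.1]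
    · rw [ih.rarr v hv.1]
  | branch_false _ _ ih =>
    constructor <;> intro v hv <;>
      simp only [Program.ivars, Program.rvars, Program.iarrs, Program.rarrs, List.mem_append,
        not_or] at hv
    · rw [ih.ivar v hv.2]
    · rw [ih.rvar v hv.2]
    · rw [ih.iarr v hv.2]
    · rw [ih.rarr v hv.2]
  | loop_true _ _ _ ih ih' =>
    refine ⟨fun v hv => ?_, fun v hv => ?_, fun v hv => ?_, fun v hv => ?_⟩
    · rw [ih'.ivar v hv, ih.ivar v hv]
    · rw [ih'.rvar v hv, ih.rvar v hv]
    · rw [ih'.iarr v hv, ih.iarr v hv]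
    · rw [ih'.rarr v hv, ih.rarr v hv]
  | loop_false => exact ⟨fun _ _ => rfl, fun _ _ => rfl, fun _ _ => rfl, fun _ _ => rfl⟩

theorem Halts.frame {P : Program} {σ : State} {T : ℕ} {Q : State → Prop} (h : Halts P σ T Q) :
    Halts P σ T (fun σ' => Q σ' ∧ Frame P σ σ') := by
  obtain ⟨t, σ', h1, h2, h3⟩ := h
  exact ⟨t, σ', h1, h2, h3, h2.frame⟩

/-! ### Counting loops -/

/-- The state with the integer variable `v` set to `x`. -/
def State.seti (σ : State) (v x : ℕ) : State := { σ with ivar := Function.update σ.ivar v x }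

@[simp] theorem State.seti_ivar_self (σ : State) (v x : ℕ) : (σ.seti v x).ivar v = x := by
  simp [State.seti]

theorem State.seti_ivar_of_ne (σ : State) {v w : ℕ} (x : ℕ) (h : w ≠ v) :
    (σ.seti v x).ivar w = σ.ivar w := by
  simp [State.seti, h]

@[simp] theorem State.seti_iarr (σ : State) (v x : ℕ) : (σ.seti v x).iarr = σ.iarr := rfl
@[simp] theorem State.seti_rarr (σ : State) (v x : ℕ) : (σ.seti v x).rarr = σ.rarr := rfl

/-- Run `P` for the values of the integer variable `v` from its current one to that of `w`,
excluded. -/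
def forLoop (v w : ℕ) (P : Program) : Program :=
  .loop (.ilt (.var v) (.var w)) (P ;; .iset v (.add (.var v) (.const 1)))

/-- The use of `seti` anticipates the increment after the body. A round costs `3` steps for the test
and `4` for the increment besides the body. -/
theorem Halts.forLoop {v w lo hi T T' : ℕ} {P : Program} (I : ℕ → State → Prop)
    (hvw : v ≠ w) (hv : v ∉ P.ivars) (hw : w ∉ P.ivars) {σ : State}
    (hlo : σ.ivar v = lo) (hhi : σ.ivar w = hi) (hle : lo ≤ hi) (h0 : I lo σ)
    (step : ∀ i σ, lo ≤ i → i < hi → σ.ivar v = i → σ.ivar w = hi → I i σ →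
      Halts P σ T (fun σ' => I (i + 1) (σ'.seti v (i + 1))))
    (hT : (hi - lo) * (T + 7) + 3 ≤ T') :
    Halts (RealRAM.forLoop v w P) σ T' (I hi) := by
  refine Halts.mono (Halts.whileLoop (T := T + 4) (c := 3)
    (fun j σ => ∃ i, lo ≤ i ∧ i + j = hi ∧ σ.ivar v = i ∧ σ.ivar w = hi ∧ I i σ) le_rfl ?_
    (j := hi - lo) ⟨lo, le_rfl, by omega, hlo, hhi, h0⟩) hT ?_
  · rintro j σ ⟨i, hi1, hi2, hi3, hi4, hi5⟩ hb
    have hlt : i < hi := by simpa [Test.Holds, IExpr.eval, hi3, hi4] using hb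
    refine ⟨j - 1, by omega, (step i σ hi1 hlt hi3 hi4 hi5).frame.seq (T' := 4) ?_ le_rfl⟩
    rintro σ' ⟨hI, hF⟩
    refine Halts.exec rfl le_rfl ?_
    have e : σ'.ivar v = i := by rw [hF.ivar v hv, hi3]
    have e' : σ'.ivar w = hi := by rw [hF.ivar w hw, hi4]
    refine ⟨i + 1, by omega, by omega, ?_, ?_, ?_⟩
    · simp [Program.exec, IExpr.eval, e]
    · simp [Program.exec, hvw.symm, e']
    · simpa [Program.exec, IExpr.eval, e, State.seti] using hI
  · rintro σ' ⟨j, ⟨i, hi1, hi2, hi3, hi4, hi5⟩, hb⟩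
    have hge : hi ≤ i := by simpa [Test.Holds, IExpr.eval, hi3, hi4] using hb
    obtain rfl : i = hi := by omega
    exact hi5

end RealRAM

namespace ColoredDominance

open RealRAM

/-! ### A binary tree of affine maps

The tree has `N = 2 ^ k` leaves; node `v` has the children `2 * v` and `2 * v + 1` and the leaves are
the nodes from `N` on.  Integer variable `2` holds `N` and integer array `6` holds the parents. -/

/-- The affine map stored at a node. -/
def node (σ : State) (v : ℕ) : Aff := ⟨σ.rarr 7 v, σ.rarr 8 v⟩

/-- Every inner node holds the product of its children. -/
def IsTree (N : ℕ) (σ : State) : Prop :=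
  ∀ w, 1 ≤ w → w < N → node σ w = node σ (2 * w) * node σ (2 * w + 1)

/-- The parents and the size of the tree are available. -/
structure TreeMem (N : ℕ) (σ : State) : Prop where
  size : σ.ivar 2 = N
  parent : ∀ v, v < 2 * N → σ.iarr 6 v = v / 2

/-- Recompute the node given by integer variable `3`. -/
def nodeProg : Program :=
  .rwrite 8 (.var 3) (.add (.read 8 (.add (.var 3) (.var 3)))
    (.mul (.read 7 (.add (.var 3) (.var 3)))
      (.read 8 (.add (.add (.var 3) (.var 3)) (.const 1))))) ;;
  .rwrite 7 (.var 3) (.mul (.read 7 (.add (.var 3) (.var 3)))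
    (.read 7 (.add (.add (.var 3) (.var 3)) (.const 1))))

theorem node_nodeProg (σ : State) (w : ℕ) :
    node (nodeProg.exec σ) w =
      if w = σ.ivar 3 then node σ (2 * σ.ivar 3) * node σ (2 * σ.ivar 3 + 1) else node σ w := by
  rcases eq_or_ne w (σ.ivar 3) with rfl | h
  · ext <;> simp [nodeProg, Program.exec, IExpr.eval, RExpr.eval, node, two_mul]
  · simp [nodeProg, Program.exec, IExpr.eval, RExpr.eval, node, h]

/-- Recompute all inner nodes. -/
def buildProg : Program :=
  .iset 3 (.var 2) ;;
  .loop (.ilt (.const 1) (.var 3)) (.iset 3 (.sub (.var 3) (.const 1)) ;; nodeProg)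

/-- Indices are visited downwards, so the children of a node are final before the node is computed.
-/
theorem buildProg_halts {N : ℕ} {σ : State} (hN : 1 ≤ N) (hσ : σ.ivar 2 = N) :
    Halts buildProg σ (50 * N) (fun σ' => IsTree N σ' ∧ ∀ w, N ≤ w → node σ' w = node σ w) := by
  refine Halts.seq (T := 2) (T' := (N - 1) * (40 + 3) + 3) (Halts.exec rfl le_rfl rfl) ?_ (by omega)
  rintro _ rfl
  refine Halts.mono (Halts.whileLoop (T := 40) (c := 3) (j := N - 1)
    (fun j σ' => σ'.ivar 3 = j + 1 ∧ j + 1 ≤ N ∧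
      (∀ w, j + 1 ≤ w → w < N → node σ' w = node σ' (2 * w) * node σ' (2 * w + 1)) ∧
      ∀ w, N ≤ w → node σ' w = node σ w) le_rfl ?_ ?_) le_rfl ?_
  · rintro j σ' ⟨h1, h2, h3, h4⟩ hb
    have hj : 0 < j := by simpa [Test.Holds, IExpr.eval, h1] using hb
    refine ⟨j - 1, by omega, Halts.exec rfl (by decide) ?_⟩
    set σ₁ := (Program.iset 3 (.sub (.var 3) (.const 1))).exec σ' with hσ₁
    have e3 : σ₁.ivar 3 = j := by simp [hσ₁, Program.exec, IExpr.eval, h1]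
    have en : node σ₁ = node σ' := rfl
    change (nodeProg.exec σ₁).ivar 3 = _ ∧ _ ∧ (∀ w, _ → _ → node (nodeProg.exec σ₁) w =
      node (nodeProg.exec σ₁) _ * node (nodeProg.exec σ₁) _) ∧
      ∀ w, _ → node (nodeProg.exec σ₁) w = _
    simp only [node_nodeProg, e3, en]
    refine ⟨by rw [show (nodeProg.exec σ₁).ivar 3 = σ₁.ivar 3 from rfl, e3]; omega, by omega,
      fun w hw1 hw2 => ?_, fun w hw => ?_⟩
    · rw [if_neg (by omega : ¬ 2 * w = j), if_neg (by omega : ¬ 2 * w + 1 = j)]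
      split_ifs with hw
      · rw [hw]
      · exact h3 w (by omega) hw2
    · rw [if_neg (by omega), h4 w hw]
  · refine ⟨by simp [Program.exec, IExpr.eval, hσ]; omega, by omega, fun w h1 h2 => by omega,
      fun w _ => rfl⟩
  · rintro σ' ⟨j, ⟨h1, h2, h3, h4⟩, hb⟩
    have hj : j = 0 := by simpa [Test.Holds, IExpr.eval, h1] using hb
    subst hj
    exact ⟨fun w hw1 hw2 => h3 w (by omega) hw2, h4⟩

/-- Store the map held by the real variables `1` and `2` in the leaf given by integer
variable `5`. -/
def leafProg : Program :=
  .rwrite 7 (.add (.var 2) (.var 5)) (.var 1) ;; .rwrite 8 (.add (.var 2) (.var 5)) (.var 2)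

theorem node_leafProg (σ : State) (w : ℕ) :
    node (leafProg.exec σ) w =
      if w = σ.ivar 2 + σ.ivar 5 then ⟨σ.rvar 1, σ.rvar 2⟩ else node σ w := by
  rcases eq_or_ne w (σ.ivar 2 + σ.ivar 5) with rfl | h
  · ext <;> simp [leafProg, Program.exec, IExpr.eval, RExpr.eval, node]
  · simp [leafProg, Program.exec, IExpr.eval, RExpr.eval, node, h]

/-- Store a map in a leaf and recompute the nodes above. -/
def updateProg : Program :=
  leafProg ;;
  .iset 3 (.read 6 (.add (.var 2) (.var 5))) ;;
  .loop (.ilt (.const 0) (.var 3)) (nodeProg ;; .iset 3 (.read 6 (.var 3)))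

/-- Only ancestors of the changed leaf can become wrong. The invariant allows the tree relation to
fail at the current node only, and the bound `2 ^ j` on that node counts the remaining levels. The
parent of the root is `0`, which ends the loop. -/
theorem updateProg_halts {k N i : ℕ} {σ : State} (hN : N = 2 ^ k) (hm : TreeMem N σ)
    (ht : IsTree N σ) (hi : i < N) (hσ : σ.ivar 5 = i) :
    Halts updateProg σ (60 * (k + 1)) (fun σ' => IsTree N σ' ∧ ∀ w, N ≤ w →
      node σ' w = if w = N + i then ⟨σ.rvar 1, σ.rvar 2⟩ else node σ w) := by
  refine Halts.seq (T := 12) (T' := 5 + (k * (40 + 3) + 3)) (Halts.exec rfl (by decide) rfl) ?_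
    (by omega)
  rintro _ rfl
  refine Halts.seq (T := 5) (T' := k * (40 + 3) + 3) (Halts.exec rfl le_rfl rfl) ?_ le_rfl
  rintro _ rfl
  have hpar : ∀ v, v < 2 * N → (leafProg.exec σ).iarr 6 v = v / 2 := hm.parent
  have hn1 := node_leafProg σ
  have hs1 : (leafProg.exec σ).ivar 2 = N := hm.size
  have h51 : (leafProg.exec σ).ivar 5 = i := hσ
  simp only [hσ, hm.size] at hn1
  set σ₁ := leafProg.exec σ
  refine Halts.mono (Halts.whileLoop (T := 40) (c := 3) (j := k)
    (fun j σ' => σ'.ivar 3 < 2 ^ j ∧ σ'.ivar 3 < N ∧ (∀ v, v < 2 * N → σ'.iarr 6 v = v / 2) ∧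
      (∀ w, 1 ≤ w → w < N → w ≠ σ'.ivar 3 →
        node σ' w = node σ' (2 * w) * node σ' (2 * w + 1)) ∧
      ∀ w, N ≤ w → node σ' w = if w = N + i then ⟨σ.rvar 1, σ.rvar 2⟩ else node σ w)
    le_rfl ?_ ?_) le_rfl ?_
  · rintro j σ' ⟨h1, h2, h3, h4, h5⟩ hb
    have hv : 0 < σ'.ivar 3 := by simpa [Test.Holds, IExpr.eval] using hb
    obtain ⟨j, rfl⟩ : ∃ l, j = l + 1 := by
      rcases j with _ | j
      · simp at h1; omega
      · exact ⟨j, rfl⟩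
    refine ⟨j, rfl, Halts.exec rfl (by decide) ?_⟩
    set v := σ'.ivar 3 with hv'
    have e3 : ((nodeProg ;; .iset 3 (.read 6 (.var 3))).exec σ').ivar 3 = v / 2 := by
      rw [← h3 v (by omega)]
      simp [Program.exec, IExpr.eval, nodeProg, hv']
    have en : node ((nodeProg ;; .iset 3 (.read 6 (.var 3))).exec σ') =
      node (nodeProg.exec σ') := rfl
    rw [e3, en]
    rw [pow_succ] at h1
    refine ⟨by omega, by omega, h3, fun w hw1 hw2 hw3 => ?_, fun w hw => ?_⟩
    · simp only [node_nodeProg, ← hv']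
      rw [if_neg (by omega : ¬ 2 * w = v), if_neg (by omega : ¬ 2 * w + 1 = v)]
      split_ifs with hw
      · rw [hw]
      · exact h4 w hw1 hw2 hw
    · rw [node_nodeProg, ← hv', if_neg (by omega), h5 w hw]
  · have e3 : ((Program.iset 3 (.read 6 (.add (.var 2) (.var 5)))).exec σ₁).ivar 3 =
        (N + i) / 2 := by
      rw [← hpar (N + i) (by omega)]
      simp [Program.exec, IExpr.eval, hs1, h51]
    have en : node ((Program.iset 3 (.read 6 (.add (.var 2) (.var 5)))).exec σ₁) = node σ₁ := rfl
    rw [e3, en, ← hN]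
    refine ⟨by omega, by omega, hpar, fun w hw1 hw2 hw3 => ?_, fun w hw => hn1 w⟩
    rw [hn1, hn1, hn1, if_neg (by omega), if_neg (by omega), if_neg (by omega), ht w hw1 hw2]
  · rintro σ' ⟨j, ⟨h1, h2, h3, h4, h5⟩, hb⟩
    have hv : σ'.ivar 3 = 0 := by simpa [Test.Holds, IExpr.eval] using hb
    exact ⟨fun w hw1 hw2 => h4 w hw1 hw2 (by omega), h5⟩

/-- Compute in the real variables `1` and `2` the product of the leaves to the right of the one
given by integer variable `5`. -/
def queryProg : Program :=
  .iset 3 (.add (.var 2) (.var 5)) ;; .rset 1 (.const 1) ;; .rset 2 (.const 0) ;;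
  .loop (.ilt (.const 1) (.var 3))
    (.iset 4 (.read 6 (.var 3)) ;;
      .branch (.ieq (.add (.var 4) (.var 4)) (.var 3))
        (.rset 2 (.add (.var 2) (.mul (.var 1) (.read 8 (.add (.var 3) (.const 1))))) ;;
          .rset 1 (.mul (.var 1) (.read 7 (.add (.var 3) (.const 1)))))
        .skip ;;
      .iset 3 (.var 4))

/-- While climbing, the right sibling is multiplied in whenever the current node is a left child.
The invariant: the accumulator times the product of the nodes further right on the current level is
the desired suffix product. At the root nothing remains to the right. -/
theorem queryProg_halts {k N i : ℕ} {σ : State} (hN : N = 2 ^ k) (hm : TreeMem N σ)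
    (ht : IsTree N σ) (hi : i < N) (hσ : σ.ivar 5 = i) :
    Halts queryProg σ (60 * (k + 1)) (fun σ' =>
      (⟨σ'.rvar 1, σ'.rvar 2⟩ : Aff) = seg (fun j => node σ (N + j)) (i + 1) N) := by
  refine Halts.seq (T := 4) (T' := 2 + (2 + (k * (40 + 3) + 3)))
    (Halts.exec rfl (by decide) rfl) ?_ (by omega)
  rintro _ rfl
  refine Halts.seq (T := 2) (T' := 2 + (k * (40 + 3) + 3)) (Halts.exec rfl le_rfl rfl) ?_ le_rfl
  rintro _ rfl
  refine Halts.seq (T := 2) (T' := k * (40 + 3) + 3) (Halts.exec rfl le_rfl rfl) ?_ le_rfl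
  rintro _ rfl
  refine Halts.mono (Halts.whileLoop (T := 40) (c := 3) (j := k)
    (fun j σ' => j ≤ k ∧ 2 ^ j ≤ σ'.ivar 3 ∧ σ'.ivar 3 < 2 ^ (j + 1) ∧
      σ'.iarr = σ.iarr ∧ σ'.rarr = σ.rarr ∧
      (⟨σ'.rvar 1, σ'.rvar 2⟩ : Aff) * seg (node σ) (σ'.ivar 3 + 1) (2 ^ (j + 1)) =
        seg (fun j => node σ (N + j)) (i + 1) N)
    le_rfl ?_ ?_) le_rfl ?_
  · rintro j σ' ⟨h0, h1, h2, h3, h4, h5⟩ hb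
    have hv : 1 < σ'.ivar 3 := by simpa [Test.Holds, IExpr.eval] using hb
    obtain ⟨j, rfl⟩ : ∃ l, j = l + 1 := by
      rcases j with _ | j
      · simp at h2; omega
      · exact ⟨j, rfl⟩
    refine ⟨j, rfl, Halts.exec rfl (by decide) ?_⟩
    have hpk : 2 ^ (j + 1) ≤ N := hN ▸ Nat.pow_le_pow_right (by norm_num) h0
    rw [pow_succ] at h1 h2 h5
    set v := σ'.ivar 3 with hv'
    have h6 : σ'.iarr 6 v = v / 2 := by rw [h3]; exact hm.parent v (by omega)
    -- The left end is `v + 2` for a left child `v` and `v + 1` for a right child; only a left child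
    -- must first absorb its sibling.
    have hd : seg (node σ) (2 * (v / 2 + 1)) (2 * 2 ^ (j + 1)) =
        seg (node σ) (v / 2 + 1) (2 ^ (j + 1)) :=
      seg_double fun w hw1 hw2 => ht w (by omega) (by omega)
    by_cases hev : v / 2 + v / 2 = v
    · simp only [Program.exec, IExpr.eval, RExpr.eval, Test.Holds, ← hv', h6, h3, h4]
      simp only [Function.update_self, ne_eq, OfNat.ofNat_ne_one, OfNat.one_ne_ofNat, Nat.reduceEqDiff,
        not_false_eq_true, Function.update_of_ne, ← hv', hev, if_true]
      refine ⟨by omega, by omega, by omega, trivial, trivial, ?_⟩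
      rw [← h5, seg_cons (node σ) (by omega : v + 1 < 2 ^ (j + 1) * 2), ← mul_assoc,
        show v + 1 + 1 = 2 * (v / 2 + 1) by omega, mul_comm (2 ^ (j + 1)) 2, hd]
      congr 1
    · simp only [Program.exec, IExpr.eval, RExpr.eval, Test.Holds, ← hv', h6, h3, h4]
      simp only [Function.update_self, ne_eq, OfNat.one_ne_ofNat, Nat.reduceEqDiff,
        not_false_eq_true, Function.update_of_ne, ← hv', hev, if_false]
      refine ⟨by omega, by omega, by omega, trivial, trivial, ?_⟩
      rw [← h5, show v + 1 = 2 * (v / 2 + 1) by omega, mul_comm (2 ^ (j + 1)) 2, hd]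
  · simp only [Program.exec, IExpr.eval, RExpr.eval, hm.size, hσ]
    have hN0 : 1 ≤ N := hN ▸ Nat.one_le_two_pow
    refine ⟨le_rfl, by simp; omega, by simp [pow_succ]; omega, trivial, trivial, ?_⟩
    rw [← seg_shift]
    simp only [Function.update_self, ne_eq, OfNat.one_ne_ofNat, not_false_eq_true, Function.update_of_ne, Rat.cast_one, Rat.cast_zero,
      pow_succ, ← hN, mul_two]
    exact one_mul _
  · rintro σ' ⟨j, ⟨h0, h1, h2, h3, h4, h5⟩, hb⟩
    have hv : σ'.ivar 3 ≤ 1 := by simpa [Test.Holds, IExpr.eval] using hb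
    rw [← h5]
    obtain rfl : j = 0 := by
      by_contra hj
      have := Nat.one_lt_two_pow hj
      omega
    rw [show σ'.ivar 3 = 1 by simp at h1; omega, seg_of_le _ (by norm_num), mul_one]

/-! ### Filling the table -/

/-- The integer arrays `ι` and the real arrays `α`, `γ` describe `K` points: `ι 1` are the colors,
`ι 2` the ranks by height, `ι 3` the points by height, `ι 4` the positions by color, `ι 5` the row
offsets of the table and `ι 6` the parents in the tree. -/
structure Describes (K k N : ℕ) (ι : ℕ → ℕ → ℕ) (α γ : ℕ → ℝ) : Prop where
  size : N = 2 ^ k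
  lt_size : K < N
  parent : ∀ v, v < 2 * N → ι 6 v = v / 2
  rank_lt : ∀ q, q < K → ι 2 q < K
  point_rank : ∀ q, q < K → ι 3 (ι 2 q) = q
  point_lt : ∀ b, b < K → ι 3 b < K
  rank_point : ∀ b, b < K → ι 2 (ι 3 b) = b
  point_last : ι 3 K = 0
  pos_lt : ∀ q < K, ι 4 q < K
  pos_surj : ∀ i < K, ∃ q < K, ι 4 q = i
  pos_lt_pos : ∀ q < K, ∀ q' < K, ι 4 q < ι 4 q' ↔ ι 1 q < ι 1 q' ∨ (ι 1 q = ι 1 q' ∧ q < q')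
  offset : ∀ b, b ≤ K → ι 5 b = b * K
  gap_eq : ∀ q, q < K → γ q = gap α (ι 1) (ι 1 q) q

/-- The memory holds the description of the points. -/
structure Mem (K N : ℕ) (ι : ℕ → ℕ → ℕ) (α γ : ℕ → ℝ) (σ : State) : Prop where
  iarr : σ.iarr = ι
  rarr5 : σ.rarr 5 = α
  rarr6 : σ.rarr 6 = γ
  ivar1 : σ.ivar 1 = K
  ivar2 : σ.ivar 2 = N
  ivar12 : σ.ivar 12 = K + 1

variable {K k N : ℕ} {ι : ℕ → ℕ → ℕ} {α γ : ℕ → ℝ}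

theorem Mem.frame {σ σ' : State} {P : Program} (h : Mem K N ι α γ σ) (hF : Frame P σ σ')
    (h1 : P.iarrs = []) (h2 : 5 ∉ P.rarrs ∧ 6 ∉ P.rarrs)
    (h3 : 1 ∉ P.ivars ∧ 2 ∉ P.ivars ∧ 12 ∉ P.ivars) : Mem K N ι α γ σ' where
  iarr := by
    rw [← h.iarr]
    funext a
    exact hF.iarr a (by simp [h1])
  rarr5 := by rw [hF.rarr 5 h2.1, h.rarr5]
  rarr6 := by rw [hF.rarr 6 h2.2, h.rarr6]
  ivar1 := by rw [hF.ivar 1 h3.1, h.ivar1]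
  ivar2 := by rw [hF.ivar 2 h3.2.1, h.ivar2]
  ivar12 := by rw [hF.ivar 12 h3.2.2, h.ivar12]

theorem Mem.seti {σ : State} (h : Mem K N ι α γ σ) {v x : ℕ}
    (h3 : 1 ≠ v ∧ 2 ≠ v ∧ 12 ≠ v) : Mem K N ι α γ (σ.seti v x) where
  iarr := h.iarr
  rarr5 := h.rarr5
  rarr6 := h.rarr6
  ivar1 := by rw [State.seti_ivar_of_ne _ _ h3.1, h.ivar1]
  ivar2 := by rw [State.seti_ivar_of_ne _ _ h3.2.1, h.ivar2]
  ivar12 := by rw [State.seti_ivar_of_ne _ _ h3.2.2, h.ivar12]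

theorem Describes.treeMem (D : Describes K k N ι α γ) {σ : State} (h : Mem K N ι α γ σ) :
    TreeMem N σ := ⟨h.ivar2, by rw [h.iarr]; exact D.parent⟩

theorem Describes.pos_inj (D : Describes K k N ι α γ) {q q' : ℕ} (hq : q < K) (hq' : q' < K)
    (h : ι 4 q = ι 4 q') : q = q' := by
  have h1 := D.pos_lt_pos q hq q' hq'
  have h2 := D.pos_lt_pos q' hq' q hq
  omega

theorem frame_exec {P : Program} (hP : P.loopFree = true) (σ : State) : Frame P σ (P.exec σ) := by
  obtain ⟨t, -, h⟩ := Program.runs_exec hP σ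
  exact h.frame

/-- The leaves beyond the one at position `K` carry no translation. -/
def Padded (K N : ℕ) (σ : State) : Prop := ∀ i, K < i → i < N → (node σ (N + i)).s = 0

/-- Prepare the tree for the points of equal color. -/
def initSameProg : Program :=
  .iset 10 (.const 0) ;;
  forLoop 10 1
    (.iset 5 (.read 4 (.var 10)) ;;
      .branch (.ilt (.read 2 (.var 10)) (.var 6))
        (.rset 1 (.read 6 (.var 10)))
        (.rset 1 (.mul (.read 6 (.var 10)) (.read 5 (.var 10)))) ;;
      .rset 2 (.const 0) ;;
      leafProg) ;;
  (.iset 5 (.var 1) ;; .rset 1 (.const 0) ;; .rset 2 (.const 0) ;; leafProg) ;;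
  buildProg

/-- Before the first point of a row is processed all translations vanish. Leaf `K` is reset because
the sweep for the other colors leaves the translation `1` there. -/
theorem initSameProg_halts (D : Describes K k N ι α γ) {σ : State} (h : Mem K N ι α γ σ) {a : ℕ}
    (ha : σ.ivar 6 = a) (hpad : Padded K N σ) :
    Halts initSameProg σ (200 * N) (fun σ' => IsTree N σ' ∧
      (∀ q, q < K → node σ' (N + ι 4 q) = ⟨γ q * (if ι 2 q < a then 1 else α q), 0⟩) ∧
      ∀ i, K ≤ i → i < N → (node σ' (N + i)).s = 0) := by
  have hKN := D.lt_size
  refine Halts.seq (T := 2) (T' := (K * (60 + 7) + 3) + (30 + 50 * N))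
    (Halts.exec rfl le_rfl rfl) ?_ (by omega)
  rintro _ rfl
  refine Halts.seq (T := K * (60 + 7) + 3) (T' := 30 + 50 * N)
    (Halts.forLoop (lo := 0) (hi := K) (T := 60)
    (fun j σ' => Mem K N ι α γ σ' ∧ σ'.ivar 6 = a ∧ Padded K N σ' ∧
      ∀ q, q < j → node σ' (N + ι 4 q) = ⟨γ q * (if ι 2 q < a then 1 else α q), 0⟩)
    (by decide) (by decide) (by decide) ?_ ?_ (Nat.zero_le _) ?_ ?_ (by omega)) ?_ le_rfl
  · simp [Program.exec, IExpr.eval]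
  · simpa [Program.exec] using h.ivar1
  · exact ⟨h.frame (frame_exec rfl _) rfl (by decide) (by decide),
      by simpa [Program.exec] using ha, hpad, fun q hq => by omega⟩
  · rintro q σ' - hq h10 - ⟨hm, h6, hp, hl⟩
    refine Halts.exec rfl (by decide) ⟨(hm.frame (frame_exec rfl σ') rfl (by decide)
      (by decide)).seti (by decide), ?_, ?_⟩
    · rw [State.seti_ivar_of_ne _ _ (by decide), (frame_exec rfl σ').ivar 6 (by decide), h6]
    · have key : ∀ w, node (((Program.iset 5 (.read 4 (.var 10)) ;;
          .branch (.ilt (.read 2 (.var 10)) (.var 6))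
            (.rset 1 (.read 6 (.var 10)))
            (.rset 1 (.mul (.read 6 (.var 10)) (.read 5 (.var 10)))) ;;
          .rset 2 (.const 0) ;; leafProg).exec σ').seti 10 (q + 1)) w =
          if w = N + ι 4 q then ⟨γ q * (if ι 2 q < a then 1 else α q), 0⟩ else node σ' w := by
        intro w
        change node (leafProg.exec _) w = _
        rw [node_leafProg]
        by_cases hr : ι 2 q < a <;>
        simp [Program.exec, IExpr.eval, RExpr.eval, Test.Holds, h10, h6, hm.iarr, hm.rarr5,
          hm.rarr6, hm.ivar2, hr] <;> rfl
      refine ⟨fun i hi1 hi2 => ?_, fun q' hq' => ?_⟩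
      · have := D.pos_lt q hq
        rw [key, if_neg (by omega), hp i hi1 hi2]
      · rw [key]
        by_cases hqq : q' = q
        · rw [hqq, if_pos rfl]
        · rw [if_neg fun e => hqq (D.pos_inj (by omega) hq (by omega)), hl q' (by omega)]
  · rintro σ₁ ⟨hm, h6, hp, hl⟩
    have key : ∀ w, node ((Program.iset 5 (.var 1) ;; .rset 1 (.const 0) ;; .rset 2 (.const 0) ;;
        leafProg).exec σ₁) w = if w = N + K then ⟨0, 0⟩ else node σ₁ w := by
      intro w
      change node (leafProg.exec _) w = _
      rw [node_leafProg]
      simp [Program.exec, IExpr.eval, RExpr.eval, hm.ivar1, hm.ivar2]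
      rfl
    refine Halts.seq (T := 30) (T' := 50 * N) (Halts.exec rfl (by decide) rfl) ?_ le_rfl
    rintro _ rfl
    have hm' := hm.frame (frame_exec (P := (Program.iset 5 (.var 1) ;; .rset 1 (.const 0) ;;
      .rset 2 (.const 0) ;; leafProg)) rfl σ₁) rfl (by decide) (by decide)
    refine (buildProg_halts (by omega) hm'.ivar2).mono le_rfl ?_
    rintro σ₂ ⟨ht, hn⟩
    refine ⟨ht, fun q hq => ?_, fun i hi1 hi2 => ?_⟩
    · have := D.pos_lt q hq
      rw [hn _ (by omega), key, if_neg (by omega), hl q hq]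
    · rw [hn _ (by omega), key]
      split_ifs with he
      · rfl
      · exact hp i (by omega) hi2

/-- The table holds the `leave` parts of all points of height below `a`. -/
def Table (K : ℕ) (ι : ℕ → ℕ → ℕ) (α : ℕ → ℝ) (a : ℕ) (τ : ℕ → ℝ) : Prop :=
  ∀ q b, q < K → ι 2 q < a → ι 2 q < b → b ≤ K → τ (b * K + q) = leave α (ι 1) (ι 2) K b q

/-- Process the next point in the row `a`. -/
def stepSameProg : Program :=
  (.iset 9 (.read 3 (.var 7)) ;; .iset 5 (.read 4 (.var 9))) ;;
  queryProg ;;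
  (.rset 2 (.add (.var 2) (.read 10 (.add (.read 5 (.var 6)) (.var 9)))) ;;
    .rwrite 9 (.var 9) (.var 2) ;;
    .rset 2 (.mul (.read 6 (.var 9)) (.mul (.sub (.const 1) (.read 5 (.var 9))) (.var 2))) ;;
    .rset 1 (.mul (.read 6 (.var 9)) (.read 5 (.var 9)))) ;;
  updateProg

/-- The factor of the point `q` in row `a` after the points of height below `b` were processed. -/
noncomputable def sameFactor (K : ℕ) (ι : ℕ → ℕ → ℕ) (α : ℕ → ℝ) (a b q : ℕ) : Aff :=
  if ι 2 q < b then ⟨α q, (1 - α q) * acceptAfter α (ι 1) (ι 2) K a q⟩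
  else ⟨if ι 2 q < a then 1 else α q, 0⟩

/-- The memory within row `a` after the points of height below `b` were processed. -/
structure SameMem (K N : ℕ) (ι : ℕ → ℕ → ℕ) (α γ : ℕ → ℝ) (τ : ℕ → ℝ) (a b : ℕ)
    (σ : State) : Prop where
  mem : Mem K N ι α γ σ
  table : σ.rarr 10 = τ
  tree : IsTree N σ
  leaf : ∀ q, q < K → node σ (N + ι 4 q) =
    ⟨γ q * (sameFactor K ι α a b q).p, γ q * (sameFactor K ι α a b q).s⟩
  pad : ∀ i, K ≤ i → i < N → (node σ (N + i)).s = 0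
  val : ∀ q, q < K → ι 2 q < b → σ.rarr 9 q = acceptAfter α (ι 1) (ι 2) K a q

/-- When `m` is next, the processed points are exactly those lower than `m`. On the color of `m`,
`sameFactor` therefore agrees with `stay` and `moveSame`; the table supplies the `leave` part. -/
theorem SameMem.seg_eq (D : Describes K k N ι α γ) {τ : ℕ → ℝ} {a m : ℕ} {σ : State}
    (h : SameMem K N ι α γ τ a (ι 2 m) σ) (hτ : Table K ι α a τ) (hm : m < K) (ha : a ≤ K)
    (hma : ι 2 m < a) :
    (seg (fun j => node σ (N + j)) (ι 4 m + 1) N).s + τ (a * K + m) =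
      acceptAfter α (ι 1) (ι 2) K a m := by
  rw [seg_grouped D.lt_size.le (α := α) (col := ι 1) (cp := ι 4) (F := sameFactor K ι α a (ι 2 m))
    D.pos_lt D.pos_surj D.pos_lt_pos
    (fun q hq => by rw [h.leaf q hq, D.gap_eq q hq]) h.pad hm, acceptAfter_eq _ _ _ _ _ _ hma,
    hτ m a hm hma hma ha]
  congr 2
  refine seg_congr fun q _ hq => ?_
  unfold sameFactor stay moveSame
  by_cases h1 : ι 1 q = ι 1 m
  · by_cases h2 : ι 2 q < ι 2 m
    · simp [h1, h2, not_le.2 h2]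
    · simp [h1, h2, not_lt.1 h2]
  · simp [h1]

/-- The value at `m` uses only lower points of the row. Afterwards `m`, the only point of height
`b`, is the only one whose `sameFactor` changes, so one leaf update suffices. -/
theorem stepSameProg_halts (D : Describes K k N ι α γ) {τ : ℕ → ℝ} {a b : ℕ} {σ : State}
    (h : SameMem K N ι α γ τ a b σ) (hτ : Table K ι α a τ) (h6 : σ.ivar 6 = a)
    (h7 : σ.ivar 7 = b) (ha : a < K) (hb : b < a) :
    Halts stepSameProg σ (200 * (k + 1)) (SameMem K N ι α γ τ a (b + 1)) := by
  have hKN := D.lt_size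
  have hm := D.point_lt b (by omega)
  have hr := D.rank_point b (by omega)
  set m := ι 3 b with hmdef
  have hp := D.pos_lt m hm
  refine Halts.seq (T := 10) (T' := 60 * (k + 1) + (50 + 60 * (k + 1)))
    (Halts.exec rfl (by decide) rfl) ?_ (by omega)
  rintro σ₁ rfl
  set σ₁ := ((Program.iset 9 (.read 3 (.var 7))) ;; .iset 5 (.read 4 (.var 9))).exec σ with hσ₁
  have hm1 : Mem K N ι α γ σ₁ :=
    h.mem.frame (frame_exec rfl σ) rfl (by decide) (by decide)
  have e5 : σ₁.ivar 5 = ι 4 m := by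
    simp [hσ₁, Program.exec, IExpr.eval, h.mem.iarr, h7, hmdef]
  have e9 : σ₁.ivar 9 = m := by
    simp [hσ₁, Program.exec, IExpr.eval, h.mem.iarr, h7, hmdef]
  have e6 : σ₁.ivar 6 = a := by
    rw [← h6]; simp [hσ₁, Program.exec]
  refine Halts.seq (queryProg_halts D.size (D.treeMem hm1) (i := ι 4 m) h.tree (by omega)
    e5).frame ?_ le_rfl
  rintro σ₂ ⟨hq, hF⟩
  have hm2 : Mem K N ι α γ σ₂ := hm1.frame hF rfl (by decide) (by decide)
  have hra : σ₂.rarr = σ.rarr := by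
    funext x
    exact hF.rarr x (by simp [queryProg, Program.rarrs])
  have hq2 : σ₂.rvar 2 + τ (a * K + m) = acceptAfter α (ι 1) (ι 2) K a m := by
    rw [← SameMem.seg_eq D (by rwa [hr]) hτ hm ha.le (by omega)]
    exact congrArg (· + _) (congrArg Aff.s hq)
  have f5 : σ₂.ivar 5 = ι 4 m := by rw [hF.ivar 5 (by decide), e5]
  have f9 : σ₂.ivar 9 = m := by rw [hF.ivar 9 (by decide), e9]
  have f6 : σ₂.ivar 6 = a := by rw [hF.ivar 6 (by decide), e6]
  refine Halts.seq (T := 50) (T' := 60 * (k + 1)) (Halts.exec rfl (by decide) rfl) ?_ le_rfl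
  rintro σ₃ rfl
  set P : Program := (.rset 2 (.add (.var 2) (.read 10 (.add (.read 5 (.var 6)) (.var 9)))) ;;
    .rwrite 9 (.var 9) (.var 2) ;;
    .rset 2 (.mul (.read 6 (.var 9)) (.mul (.sub (.const 1) (.read 5 (.var 9))) (.var 2))) ;;
    .rset 1 (.mul (.read 6 (.var 9)) (.read 5 (.var 9)))) with hP
  have hF3 : Frame P σ₂ (P.exec σ₂) := frame_exec rfl _
  have hm3 : Mem K N ι α γ (P.exec σ₂) := hm2.frame hF3 rfl (by decide) (by decide)
  have g1 : (P.exec σ₂).rvar 1 = γ m * α m := by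
    simp [hP, Program.exec, IExpr.eval, RExpr.eval, f9, hm2.rarr5, hm2.rarr6]
  have ev : σ₂.rvar 2 + σ₂.rarr 10 (σ₂.iarr 5 (σ₂.ivar 6) + σ₂.ivar 9) =
      acceptAfter α (ι 1) (ι 2) K a m := by
    rw [hra, h.table, hm2.iarr, f6, f9, D.offset a ha.le, hq2]
  have g2 : (P.exec σ₂).rvar 2 =
      γ m * ((1 - α m) * acceptAfter α (ι 1) (ι 2) K a m) := by
    simp [hP, Program.exec, IExpr.eval, RExpr.eval, f9, hm2.rarr5, hm2.rarr6, ← ev]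
  have g9 : (P.exec σ₂).rarr 9 =
      Function.update (σ.rarr 9) m (acceptAfter α (ι 1) (ι 2) K a m) := by
    rw [← ev, ← hra]
    simp [hP, Program.exec, IExpr.eval, RExpr.eval, f9]
  have gn : node (P.exec σ₂) = node σ := by
    funext w
    rw [node, node, hF3.rarr 7 (by decide), hF3.rarr 8 (by decide), hra]
  have g5 : (P.exec σ₂).ivar 5 = ι 4 m := by rw [hF3.ivar 5 (by decide), f5]
  have gt : IsTree N (P.exec σ₂) := by rw [IsTree, gn]; exact h.tree
  refine (updateProg_halts D.size (D.treeMem hm3) gt (i := ι 4 m) (by omega)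
    g5).frame.mono le_rfl ?_
  rintro σ₄ ⟨⟨ht, hn⟩, hF4⟩
  have h94 : σ₄.rarr 9 = Function.update (σ.rarr 9) m (acceptAfter α (ι 1) (ι 2) K a m) := by
    rw [hF4.rarr 9 (by decide), g9]
  refine ⟨hm3.frame hF4 rfl (by decide) (by decide), ?_, ht, fun q hq => ?_, fun i h1 h2 => ?_,
    fun q hq hqb => ?_⟩
  · rw [hF4.rarr 10 (by decide), hF3.rarr 10 (by decide), hra, h.table]
  · rw [hn _ (by omega), g1, g2, gn]
    by_cases hqm : q = m
    · subst hqm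
      rw [if_pos rfl, sameFactor, if_pos (by omega)]
    · rw [if_neg fun e => hqm (D.pos_inj hq hm (by omega)), h.leaf q hq]
      have : ι 2 q ≠ b := fun e => hqm (by rw [hmdef, ← e, D.point_rank q hq])
      have : ι 2 q < b + 1 ↔ ι 2 q < b := by omega
      simp only [sameFactor, this]
  · rw [hn _ (by omega), if_neg (by omega), gn]
    exact h.pad i h1 h2
  · rw [h94]
    by_cases hqm : q = m
    · rw [hqm, Function.update_self]
    · rw [Function.update_of_ne hqm]
      have : ι 2 q ≠ b := fun e => hqm (by rw [hmdef, ← e, D.point_rank q hq])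
      exact h.val q hq (by omega)

/-- Compute the acceptance probabilities of row `a`. -/
def sameProg : Program :=
  initSameProg ;; .iset 7 (.const 0) ;; forLoop 7 6 stepSameProg

theorem sameProg_halts (D : Describes K k N ι α γ) {a : ℕ} {σ : State}
    (h : Mem K N ι α γ σ) (hτ : Table K ι α a (σ.rarr 10)) (h6 : σ.ivar 6 = a)
    (ha : a < K) (hpad : Padded K N σ) :
    Halts sameProg σ (420 * N * (k + 1)) (fun σ' => Padded K N σ' ∧
      ∀ q, q < K → ι 2 q < a → σ'.rarr 9 q = acceptAfter α (ι 1) (ι 2) K a q) := by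
  have hKN := D.lt_size
  refine Halts.seq (T := 200 * N) (T' := 2 + (a * (200 * (k + 1) + 7) + 3))
    (initSameProg_halts D h h6 hpad).frame ?_ ?_
  swap
  · have : a + 1 ≤ N := by omega
    nlinarith
  rintro σ₁ ⟨⟨ht, hl, hp⟩, hF⟩
  refine Halts.seq (T := 2) (Halts.exec rfl le_rfl rfl) ?_ le_rfl
  rintro σ₂ rfl
  have hF2 := frame_exec (P := Program.iset 7 (.const 0)) rfl σ₁
  have hm2 : Mem K N ι α γ _ := (h.frame hF rfl (by decide) (by decide)).frame hF2 rfl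
    (by decide) (by decide)
  refine Halts.mono (Halts.forLoop (lo := 0) (hi := a) (T := 200 * (k + 1))
    (fun b σ' => SameMem K N ι α γ (σ.rarr 10) a b σ') (by decide) (by decide) (by decide) ?_ ?_
    (Nat.zero_le _) ⟨hm2, ?_, ht, fun q hq => ?_, hp, fun q _ hq => by omega⟩ ?_ le_rfl)
    (by simp) ?_
  · simp [Program.exec, IExpr.eval]
  · rw [hF2.ivar 6 (by decide), hF.ivar 6 (by decide), h6]
  · rw [hF2.rarr 10 (by decide), hF.rarr 10 (by decide)]
  · refine (hl q hq).trans ?_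
    simp [sameFactor]
  · rintro b σ' - hb h7 h6 hs
    refine (stepSameProg_halts D hs hτ h6 h7 ha hb).mono le_rfl fun σ'' h => ?_
    exact ⟨h.mem.seti (by decide), h.table, h.tree, h.leaf, h.pad, h.val⟩
  · rintro σ' h
    exact ⟨fun i h1 h2 => h.pad i h1.le h2, h.val⟩

/-! ### Columns of the table: moves to another color -/

/-- The leaf of one point in the tree for the points of another color. -/
def leafOtherProg : Program :=
  .iset 5 (.var 10) ;; .rset 1 (.read 5 (.var 10)) ;; .rset 2 (.const 0) ;;
  .branch (.ilt (.read 2 (.var 10)) (.var 6))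
    (.branch (.ieq (.read 1 (.var 10)) (.read 1 (.var 8))) .skip
      (.rset 2 (.mul (.sub (.const 1) (.var 1)) (.read 9 (.var 10)))))
    .skip ;;
  leafProg

/-- Prepare the tree for the points of another color. -/
def initOtherProg : Program :=
  (.iset 8 (.read 3 (.var 6)) ;; .iset 10 (.const 0)) ;;
  forLoop 10 1 leafOtherProg ;;
  (.iset 5 (.var 1) ;; .rset 1 (.const 0) ;; .rset 2 (.const 1) ;; leafProg) ;;
  buildProg

/-- For the point of height `a`, `moveOther` refers to states `(a, q)` only, and these values were
just computed in row `a`. -/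
theorem initOtherProg_halts (D : Describes K k N ι α γ) {σ : State} (h : Mem K N ι α γ σ) {a : ℕ}
    (h6 : σ.ivar 6 = a) (ha : a < K) (hpad : Padded K N σ)
    (hval : ∀ q, q < K → ι 2 q < a → σ.rarr 9 q = acceptAfter α (ι 1) (ι 2) K a q) :
    Halts initOtherProg σ (200 * N) (fun σ' => IsTree N σ' ∧ σ'.ivar 8 = ι 3 a ∧
      (∀ q, q < K → node σ' (N + q) = ⟨α q, moveOther α (ι 1) (ι 2) K (ι 3 a) q⟩) ∧
      node σ' (N + K) = ⟨0, 1⟩ ∧ Padded K N σ') := by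
  have hKN := D.lt_size
  have hr := D.rank_point a ha
  refine Halts.seq (T := 10) (T' := (K * (60 + 7) + 3) + (30 + 50 * N))
    (Halts.exec rfl (by decide) rfl) ?_ (by omega)
  rintro σ₁ rfl
  have hF1 := frame_exec (P := ((Program.iset 8 (.read 3 (.var 6))) ;; .iset 10 (.const 0))) rfl σ
  set σ₁ := ((Program.iset 8 (.read 3 (.var 6))) ;; .iset 10 (.const 0)).exec σ with hσ₁
  have hm1 : Mem K N ι α γ σ₁ := h.frame hF1 rfl (by decide) (by decide)
  have e8 : σ₁.ivar 8 = ι 3 a := by simp [hσ₁, Program.exec, IExpr.eval, h.iarr, h6]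
  refine Halts.seq (T := K * (60 + 7) + 3) (T' := 30 + 50 * N)
    (Halts.forLoop (lo := 0) (hi := K) (T := 60)
    (fun j σ' => Mem K N ι α γ σ' ∧ σ'.ivar 6 = a ∧ σ'.ivar 8 = ι 3 a ∧
      σ'.rarr 9 = σ.rarr 9 ∧ Padded K N σ' ∧
      ∀ q, q < j → node σ' (N + q) = ⟨α q, moveOther α (ι 1) (ι 2) K (ι 3 a) q⟩)
    (by decide) (by decide) (by decide) ?_ hm1.ivar1 (Nat.zero_le _) ?_ ?_ (by omega)) ?_ le_rfl
  · simp [hσ₁, Program.exec, IExpr.eval]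
  · exact ⟨hm1, by rw [hF1.ivar 6 (by decide), h6], e8, rfl, hpad, fun q hq => by omega⟩
  · rintro q σ' - hq h10 - ⟨hm, h6, h8, h9, hp, hl⟩
    have hF := frame_exec (P := leafOtherProg) rfl σ'
    refine Halts.exec rfl (by decide) ⟨(hm.frame hF rfl (by decide)
      (by decide)).seti (by decide), ?_, ?_, ?_, ?_⟩
    · rw [State.seti_ivar_of_ne _ _ (by decide), hF.ivar 6 (by decide), h6]
    · rw [State.seti_ivar_of_ne _ _ (by decide), hF.ivar 8 (by decide), h8]
    · rw [State.seti_rarr, hF.rarr 9 (by decide), h9]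
    · have key : ∀ w, node ((leafOtherProg.exec σ').seti 10 (q + 1)) w =
          if w = N + q then ⟨α q, moveOther α (ι 1) (ι 2) K (ι 3 a) q⟩ else node σ' w := by
        intro w
        change node (leafProg.exec _) w = _
        rw [node_leafProg, moveOther, hr]
        by_cases h1 : ι 2 q < a
        · by_cases h2 : ι 1 q = ι 1 (ι 3 a)
          · simp [Program.exec, IExpr.eval, RExpr.eval, Test.Holds, h10, h6, h8, hm.iarr, hm.rarr5,
              hm.ivar2, h1, h2]
            rfl
          · simp [Program.exec, IExpr.eval, RExpr.eval, Test.Holds, h10, h6, h8, hm.iarr, hm.rarr5,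
              hm.ivar2, h1, h2, h9, hval q hq h1]
            rfl
        · simp [Program.exec, IExpr.eval, RExpr.eval, Test.Holds, h10, h6, hm.iarr, hm.rarr5,
            hm.ivar2, h1]
          rfl
      refine ⟨fun i hi1 hi2 => ?_, fun q' hq' => ?_⟩
      · rw [key, if_neg (by omega), hp i hi1 hi2]
      · rw [key]
        by_cases hqq : q' = q
        · rw [hqq, if_pos rfl]
        · rw [if_neg fun e => hqq (by omega), hl q' (by omega)]
  · rintro σ₂ ⟨hm, -, h8, -, hp, hl⟩
    have key : ∀ w, node ((Program.iset 5 (.var 1) ;; .rset 1 (.const 0) ;; .rset 2 (.const 1) ;;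
        leafProg).exec σ₂) w = if w = N + K then ⟨0, 1⟩ else node σ₂ w := by
      intro w
      change node (leafProg.exec _) w = _
      rw [node_leafProg]
      simp [Program.exec, IExpr.eval, RExpr.eval, hm.ivar1, hm.ivar2]
      rfl
    refine Halts.seq (T := 30) (T' := 50 * N) (Halts.exec rfl (by decide) rfl) ?_ le_rfl
    rintro _ rfl
    have hF2 := frame_exec (P := (Program.iset 5 (.var 1) ;; .rset 1 (.const 0) ;;
      .rset 2 (.const 1) ;; leafProg)) rfl σ₂
    have hm' := hm.frame hF2 rfl (by decide) (by decide)
    refine (buildProg_halts (by omega) hm'.ivar2).frame.mono le_rfl ?_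
    rintro σ₃ ⟨⟨ht, hn⟩, hF3⟩
    refine ⟨ht, ?_, fun q hq => ?_, ?_, fun i hi1 hi2 => ?_⟩
    · rw [hF3.ivar 8 (by decide), hF2.ivar 8 (by decide), h8]
    · rw [hn _ (by omega), key, if_neg (by omega), hl q hq]
    · rw [hn _ (by omega), key, if_pos rfl]
    · rw [hn _ (by omega), key, if_neg (by omega), hp i hi1 hi2]

/-- The memory within column `m` after the rows below `b` were processed. -/
structure OtherMem (K N : ℕ) (ι : ℕ → ℕ → ℕ) (α γ : ℕ → ℝ) (τ : ℕ → ℝ) (m b : ℕ)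
    (σ : State) : Prop where
  mem : Mem K N ι α γ σ
  ivar8 : σ.ivar 8 = m
  tree : IsTree N σ
  leaf : ∀ q, m < q → q < K → node σ (N + q) =
    ⟨stay α (ι 1) (ι 2) b m q, moveOther α (ι 1) (ι 2) K m q⟩
  last : node σ (N + K) = ⟨0, 1⟩
  pad : Padded K N σ
  new : ∀ b', ι 2 m < b' → b' < b → σ.rarr 10 (b' * K + m) = leave α (ι 1) (ι 2) K b' m
  old : ∀ x, (∀ b', x ≠ b' * K + m) → σ.rarr 10 x = τ x

/-- Leaf `K` is the constant map `1`: it turns the translation of the suffix product into its value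
at `1` and hides all leaves behind it. -/
theorem OtherMem.seg_eq (D : Describes K k N ι α γ) {τ : ℕ → ℝ} {b m : ℕ} {σ : State}
    (h : OtherMem K N ι α γ τ m b σ) (hm : m < K) :
    (seg (fun j => node σ (N + j)) (m + 1) N).s = leave α (ι 1) (ι 2) K b m := by
  have hKN := D.lt_size
  rw [← seg_append _ (by omega : m + 1 ≤ K) hKN.le, seg_cons _ hKN, h.last, leave,
    seg_congr (g := fun q => ⟨stay α (ι 1) (ι 2) b m q, moveOther α (ι 1) (ι 2) K m q⟩)
      (fun i h1 h2 => h.leaf i (by omega) h2)]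
  simp

/-- Compute the next entry of the column of the point given by integer variable `8`. -/
def stepOtherProg : Program :=
  .iset 5 (.var 8) ;;
  queryProg ;;
  (.rwrite 10 (.add (.read 5 (.var 7)) (.var 8)) (.var 2) ;;
    .iset 5 (.read 3 (.var 7)) ;; .rset 1 (.const 1) ;; .rset 2 (.const 0)) ;;
  .branch (.ieq (.read 1 (.var 5)) (.read 1 (.var 8))) updateProg .skip

/-- Raising the threshold past `b` affects `stay` only at the point of height `b`, and only if it
has the color of `m`. Its factor then becomes the identity, since `moveOther` vanishes on that
color. -/
theorem stepOtherProg_halts (D : Describes K k N ι α γ) {τ : ℕ → ℝ} {b m : ℕ} {σ : State}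
    (h : OtherMem K N ι α γ τ m b σ) (h7 : σ.ivar 7 = b) (hm : m < K) (hb : ι 2 m < b)
    (hbK : b ≤ K) : Halts stepOtherProg σ (200 * (k + 1)) (OtherMem K N ι α γ τ m (b + 1)) := by
  have hKN := D.lt_size
  refine Halts.seq (T := 2) (T' := 60 * (k + 1) + (30 + (20 + 60 * (k + 1))))
    (Halts.exec rfl (by decide) rfl) ?_ (by omega)
  rintro σ₁ rfl
  have hF1 := frame_exec (P := Program.iset 5 (.var 8)) rfl σ
  set σ₁ := (Program.iset 5 (.var 8)).exec σ with hσ₁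
  have hm1 : Mem K N ι α γ σ₁ := h.mem.frame hF1 rfl (by decide) (by decide)
  have e5 : σ₁.ivar 5 = m := by simp [hσ₁, Program.exec, IExpr.eval, h.ivar8]
  refine Halts.seq (queryProg_halts D.size (D.treeMem hm1) (i := m) h.tree (by omega)
    e5).frame ?_ le_rfl
  rintro σ₂ ⟨hq, hF⟩
  have hm2 : Mem K N ι α γ σ₂ := hm1.frame hF rfl (by decide) (by decide)
  have hra : σ₂.rarr = σ.rarr := by
    funext x
    exact hF.rarr x (by simp [queryProg, Program.rarrs])
  have hq2 : σ₂.rvar 2 = leave α (ι 1) (ι 2) K b m := by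
    rw [← h.seg_eq D hm]
    exact congrArg Aff.s hq
  have f7 : σ₂.ivar 7 = b := by rw [hF.ivar 7 (by decide), hF1.ivar 7 (by decide), h7]
  have f8 : σ₂.ivar 8 = m := by rw [hF.ivar 8 (by decide), hF1.ivar 8 (by decide), h.ivar8]
  refine Halts.seq (T := 30) (T' := 20 + 60 * (k + 1)) (Halts.exec rfl (by decide) rfl) ?_ le_rfl
  rintro σ₃ rfl
  set P : Program := (.rwrite 10 (.add (.read 5 (.var 7)) (.var 8)) (.var 2) ;;
    .iset 5 (.read 3 (.var 7)) ;; .rset 1 (.const 1) ;; .rset 2 (.const 0)) with hP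
  have hF3 : Frame P σ₂ (P.exec σ₂) := frame_exec rfl _
  have hm3 : Mem K N ι α γ (P.exec σ₂) := hm2.frame hF3 rfl (by decide) (by decide)
  have g1 : (P.exec σ₂).rvar 1 = 1 := by simp [hP, Program.exec, RExpr.eval]
  have g2 : (P.exec σ₂).rvar 2 = 0 := by simp [hP, Program.exec, RExpr.eval]
  have g5 : (P.exec σ₂).ivar 5 = ι 3 b := by
    simp [hP, Program.exec, IExpr.eval, hm2.iarr, f7]
  have g8 : (P.exec σ₂).ivar 8 = m := by rw [hF3.ivar 8 (by decide), f8]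
  have g10 : (P.exec σ₂).rarr 10 =
      Function.update (σ.rarr 10) (b * K + m) (leave α (ι 1) (ι 2) K b m) := by
    rw [← hq2, ← hra, ← D.offset b hbK]
    simp [hP, Program.exec, IExpr.eval, RExpr.eval, f7, f8, hm2.iarr]
  have gn : node (P.exec σ₂) = node σ := by
    funext w
    rw [node, node, hF3.rarr 7 (by decide), hF3.rarr 8 (by decide), hra]
  have gt : IsTree N (P.exec σ₂) := by rw [IsTree, gn]; exact h.tree
  have hnew : ∀ b', ι 2 m < b' → b' < b + 1 →
      (P.exec σ₂).rarr 10 (b' * K + m) = leave α (ι 1) (ι 2) K b' m := by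
    intro b' h1 h2
    rw [g10]
    rcases eq_or_ne b' b with rfl | hne
    · rw [Function.update_self]
    · rw [Function.update_of_ne, h.new b' h1 (by omega)]
      intro he
      exact hne (Nat.eq_of_mul_eq_mul_right (by omega) (Nat.add_right_cancel he))
  have hold : ∀ x, (∀ b', x ≠ b' * K + m) → (P.exec σ₂).rarr 10 x = τ x := by
    intro x hx
    rw [g10, Function.update_of_ne (hx b), h.old x hx]
  -- No point has height `K`; there `ι 3 K = 0` names the dummy, whose leaf lies left of every
  -- queried suffix, so a change of it is harmless.
  have hbpt : ι 3 b < K := by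
    rcases eq_or_lt_of_le hbK with rfl | hlt
    · rw [D.point_last]; omega
    · exact D.point_lt b hlt
  have hstay : ∀ q, m < q → q < K → (q ≠ ι 3 b ∨ ι 1 q ≠ ι 1 m) →
      stay α (ι 1) (ι 2) (b + 1) m q = stay α (ι 1) (ι 2) b m q := by
    intro q h1 h2 h3
    unfold stay
    by_cases hc : ι 1 q = ι 1 m
    · have : ι 2 q ≠ b := fun e => by
        rcases h3 with h3 | h3
        · exact h3 (by rw [← e, D.point_rank q h2])
        · exact h3 hc
      have : ι 2 q < b + 1 ↔ ι 2 q < b := by omega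
      simp only [this]
    · simp [hc]
  refine Halts.branch (T := 60 * (k + 1)) (fun hc => ?_) (fun hc => ?_) (by simp [Test.cost, IExpr.cost])
  · have hc' : ι 1 (ι 3 b) = ι 1 m := by
      simpa [Test.Holds, IExpr.eval, hm3.iarr, g5, g8] using hc
    refine (updateProg_halts D.size (D.treeMem hm3) gt (i := ι 3 b) (by omega)
      g5).frame.mono le_rfl ?_
    rintro σ₄ ⟨⟨ht, hn⟩, hF4⟩
    have h10 : σ₄.rarr 10 = (P.exec σ₂).rarr 10 := hF4.rarr 10 (by decide)
    refine ⟨hm3.frame hF4 rfl (by decide) (by decide), ?_, ht, fun q hq1 hq2 => ?_, ?_,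
      fun i h1 h2 => ?_, ?_, ?_⟩
    · rw [hF4.ivar 8 (by decide), g8]
    · rw [hn _ (by omega), g1, g2, gn]
      by_cases hqm : q = ι 3 b
      · have hbK' : b < K := by
          rcases eq_or_lt_of_le hbK with rfl | hlt
          · rw [D.point_last] at hqm; omega
          · exact hlt
        have hrb := D.rank_point b hbK'
        rw [if_pos (by rw [hqm]), stay, if_pos, moveOther, if_neg (by rw [hqm]; simp [hc'])]
        rw [hqm]
        exact ⟨hc', by omega, by omega⟩
      · rw [if_neg fun e => hqm (by omega), h.leaf q hq1 hq2, hstay q hq1 hq2 (Or.inl hqm)]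
    · rw [hn _ (by omega), if_neg (by omega), gn, h.last]
    · rw [hn _ (by omega), if_neg (by omega), gn]
      exact h.pad i h1 h2
    · rw [h10]; exact hnew
    · rw [h10]; exact hold
  · have hc' : ι 1 (ι 3 b) ≠ ι 1 m := by
      simpa [Test.Holds, IExpr.eval, hm3.iarr, g5, g8] using hc
    refine Halts.exec rfl (by simp only [Program.cost]; omega) ?_
    change OtherMem K N ι α γ τ m (b + 1) (P.exec σ₂)
    refine ⟨hm3, g8, gt, fun q hq1 hq2 => ?_, ?_, fun i h1 h2 => ?_, hnew, hold⟩
    · rw [gn, h.leaf q hq1 hq2, hstay q hq1 hq2]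
      by_cases hqm : q = ι 3 b
      · exact Or.inr (by rw [hqm]; exact hc')
      · exact Or.inl hqm
    · rw [gn, h.last]
    · rw [gn]; exact h.pad i h1 h2

/-- Compute the column of the point of height `a` in the table. -/
def otherProg : Program :=
  initOtherProg ;; .iset 7 (.add (.var 6) (.const 1)) ;; forLoop 7 12 stepOtherProg

theorem otherProg_halts (D : Describes K k N ι α γ) {σ : State} (h : Mem K N ι α γ σ) {a : ℕ}
    (h6 : σ.ivar 6 = a) (ha : a < K) (hpad : Padded K N σ) (hτ : Table K ι α a (σ.rarr 10))
    (hval : ∀ q, q < K → ι 2 q < a → σ.rarr 9 q = acceptAfter α (ι 1) (ι 2) K a q) :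
    Halts otherProg σ (420 * N * (k + 1)) (fun σ' => Padded K N σ' ∧
      Table K ι α (a + 1) (σ'.rarr 10)) := by
  have hKN := D.lt_size
  have hm := D.point_lt a ha
  have hr := D.rank_point a ha
  refine Halts.seq (T := 200 * N) (T' := 4 + ((K + 1 - (a + 1)) * (200 * (k + 1) + 7) + 3))
    (initOtherProg_halts D h h6 ha hpad hval).frame ?_ ?_
  swap
  · have : K + 1 - (a + 1) ≤ N := by omega
    have : 1 ≤ N := by omega
    nlinarith
  rintro σ₁ ⟨⟨ht, h8, hl, hK, hp⟩, hF⟩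
  refine Halts.seq (T := 4) (Halts.exec rfl le_rfl rfl) ?_ le_rfl
  rintro σ₂ rfl
  have hF2 := frame_exec (P := Program.iset 7 (.add (.var 6) (.const 1))) rfl σ₁
  have hm2 : Mem K N ι α γ _ := (h.frame hF rfl (by decide) (by decide)).frame hF2 rfl
    (by decide) (by decide)
  refine Halts.mono (Halts.forLoop (lo := a + 1) (hi := K + 1) (T := 200 * (k + 1))
    (fun b σ' => OtherMem K N ι α γ (σ.rarr 10) (ι 3 a) b σ') (by decide) (by decide) (by decide)
    ?_ hm2.ivar12 (by omega) ⟨hm2, ?_, ht, fun q hq1 hq2 => ?_, hK, hp, fun b' _ _ => by omega, ?_⟩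
    ?_ le_rfl) le_rfl ?_
  · simp [Program.exec, IExpr.eval, hF.ivar 6 (by decide), h6]
  · rw [hF2.ivar 8 (by decide), h8]
  · refine (hl q hq2).trans ?_
    -- For the first threshold `a + 1` only `m` itself has its height in `[a, a + 1)`, so all later
    -- points start with factor `α q`.
    have : ι 2 q ≠ a := fun e => by
      have := D.point_rank q hq2
      rw [e] at this
      omega
    rw [stay, if_neg (by omega)]
  · intro x _
    rw [hF2.rarr 10 (by decide), hF.rarr 10 (by decide)]
  · rintro b σ' hb1 hb2 h7 - hs
    refine (stepOtherProg_halts D hs h7 hm (by omega) (by omega)).mono le_rfl fun σ'' h => ?_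
    exact ⟨h.mem.seti (by decide), by rw [State.seti_ivar_of_ne _ _ (by decide), h.ivar8],
      h.tree, h.leaf, h.last, h.pad, h.new, h.old⟩
  · rintro σ' h
    refine ⟨h.pad, fun q b hq hqa hqb hbK => ?_⟩
    by_cases hqm : q = ι 3 a
    · rw [hqm] at hqb ⊢
      exact h.new b hqb (by omega)
    · have : ι 2 q ≠ a := fun e => hqm (by rw [← e, D.point_rank q hq])
      rw [h.old, hτ q b hq (by omega) hqb hbK]
      -- Entries of different columns differ modulo `K`.
      intro b' he
      have := congrArg (· % K) he
      simp only [Nat.mul_add_mod', Nat.mod_eq_of_lt hq, Nat.mod_eq_of_lt hm] at this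
      exact hqm this

/-! ### Assembly of the table -/

/-- Fill the table and output the answer. -/
def tableProg : Program :=
  .iset 6 (.const 0) ;;
  forLoop 6 1 (sameProg ;; otherProg) ;;
  .rset 0 (.sub (.const 1) (.read 10 (.read 5 (.var 1))))

/-- Row `a` needs the columns of points lower than `a`, and the column of the point of height `a`
needs row `a`. By `h0` no other point has the color of the dummy, so the same-color part of its
value is `0` and the answer is read from the single entry `K * K`. -/
theorem tableProg_halts (D : Describes K k N ι α γ) {σ : State} (h : Mem K N ι α γ σ)
    (hK : 1 ≤ K) (h0 : ∀ q, 1 ≤ q → q < K → ι 1 q ≠ ι 1 0) (hpad : Padded K N σ) :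
    Halts tableProg σ (1000 * K * N * (k + 1)) (fun σ' =>
      σ'.rvar 0 = 1 - acceptAfter α (ι 1) (ι 2) K K 0) := by
  have hKN := D.lt_size
  refine Halts.seq (T := 2) (T' := (K * (840 * N * (k + 1) + 7) + 3) + 6)
    (Halts.exec rfl le_rfl rfl) ?_ ?_
  swap
  · have h1 : K ≤ K * N := Nat.le_mul_of_pos_right _ (by omega)
    have h2 : K * N ≤ K * N * (k + 1) := Nat.le_mul_of_pos_right _ (by omega)
    nlinarith
  rintro σ₁ rfl
  have hF1 := frame_exec (P := Program.iset 6 (.const 0)) rfl σ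
  have hm1 := h.frame hF1 rfl (by decide) (by decide)
  refine Halts.seq (Halts.forLoop (lo := 0) (hi := K) (T := 840 * N * (k + 1))
    (fun a σ' => Mem K N ι α γ σ' ∧ Padded K N σ' ∧ Table K ι α a (σ'.rarr 10))
    (by decide) (by decide) (by decide) ?_ hm1.ivar1 (Nat.zero_le _)
    ⟨hm1, hpad, fun q b _ hq => by omega⟩ ?_ le_rfl) ?_ le_rfl
  · simp [Program.exec, IExpr.eval]
  · rintro a σ' - ha h6 - ⟨hm, hp, ht⟩
    refine Halts.seq (sameProg_halts D hm ht h6 ha hp).frame ?_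
      (by ring_nf; exact le_rfl : 420 * N * (k + 1) + 420 * N * (k + 1) ≤ _)
    rintro σ₂ ⟨⟨hp2, hv⟩, hF2⟩
    have hm2 := hm.frame hF2 rfl (by decide) (by decide)
    refine (otherProg_halts D hm2 (by rw [hF2.ivar 6 (by decide), h6]) ha hp2
      (by rw [hF2.rarr 10 (by decide)]; exact ht) hv).frame.mono le_rfl ?_
    rintro σ₃ ⟨⟨hp3, ht3⟩, hF3⟩
    exact ⟨(hm2.frame hF3 rfl (by decide) (by decide)).seti (by decide), hp3, ht3⟩
  · rintro σ₂ ⟨hm, -, ht⟩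
    refine Halts.exec rfl (by decide) ?_
    have e : (Program.exec (.rset 0 (.sub (.const 1) (.read 10 (.read 5 (.var 1))))) σ₂).rvar 0 =
        1 - σ₂.rarr 10 (ι 5 K) := by
      simp [Program.exec, RExpr.eval, IExpr.eval, hm.iarr, hm.ivar1]
    have h20 := D.rank_lt 0 hK
    have := ht 0 K hK h20 h20 le_rfl
    rw [e, D.offset K le_rfl, ← add_zero (K * K), this, acceptAfter_eq _ _ _ _ _ _ h20,
      seg_s_eq_zero, zero_add]
    intro q h1 h2
    simp [moveSame, h0 q (by omega) h2]

end ColoredDominance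

namespace ColoredDominance

open RealRAM

/-! ### Preprocessing -/

/-- Count in integer variable `11` the values of integer variable `7` below that of `w` which
satisfy `b₁`, or `b₂` and `b₃`. -/
def countProg (w : ℕ) (b₁ b₂ b₃ : Test) : Program :=
  forLoop 7 w (.branch b₁ (.iset 11 (.add (.var 11) (.const 1)))
    (.branch b₂ (.branch b₃ (.iset 11 (.add (.var 11) (.const 1))) .skip) .skip))

-- Counting predecessors gives ranks in quadratic total time, which is affordable. Tests of the
-- shape `b₁ ∨ (b₂ ∧ b₃)` cover the lexicographic, height and color orders. `hlt` ranges over all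
-- counter values because the tests are made while the counter varies.
open Classical in
theorem countProg_halts {w lo hi c : ℕ} {b₁ b₂ b₃ : Test} {σ : State} (lt : ℕ → Prop)
    (hw : w ≠ 7 ∧ w ≠ 11) (h7 : σ.ivar 7 = lo) (h11 : σ.ivar 11 = c) (hhi : σ.ivar w = hi)
    (hle : lo ≤ hi) (hcost : b₁.cost ≤ 15 ∧ b₂.cost ≤ 15 ∧ b₃.cost ≤ 15)
    (hlt : ∀ j c, lo ≤ j → j < hi →
      (b₁.Holds ((σ.seti 11 c).seti 7 j) ∨
        (b₂.Holds ((σ.seti 11 c).seti 7 j) ∧ b₃.Holds ((σ.seti 11 c).seti 7 j)) ↔ lt j)) :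
    Halts (countProg w b₁ b₂ b₃) σ (60 * hi + 3) (fun σ' =>
      σ'.ivar 11 = c + ((Finset.Ico lo hi).filter lt).card ∧
      (∀ v, v ≠ 7 → v ≠ 11 → σ'.ivar v = σ.ivar v) ∧
      σ'.rvar = σ.rvar ∧ σ'.iarr = σ.iarr ∧ σ'.rarr = σ.rarr) := by
  refine Halts.mono (Halts.forLoop (lo := lo) (hi := hi) (T := 50)
    (fun j σ' => σ' = (σ.seti 11 (c + ((Finset.Ico lo j).filter lt).card)).seti 7 j)
    (Ne.symm hw.1) (by simp [Program.ivars]) (by simp [Program.ivars, hw.2]) h7 hhi hle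
    ?_ ?_ le_rfl) (by omega) ?_
  · simp [State.seti, ← h7, ← h11]
  · rintro j σ' hj1 hj2 - - rfl
    refine Halts.exec rfl (by simp only [Program.cost, IExpr.cost]; omega) ?_
    have hcard : ((Finset.Ico lo (j + 1)).filter lt).card =
        ((Finset.Ico lo j).filter lt).card + if lt j then 1 else 0 := by
      rw [← Finset.insert_Ico_right_eq_Ico_add_one hj1, Finset.filter_insert]
      split_ifs with h
      · rw [Finset.card_insert_of_notMem (by simp)]
      · rfl
    have hl := hlt j (c + ((Finset.Ico lo j).filter lt).card) hj1 hj2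
    have up : ∀ x y : ℕ, Function.update (Function.update (Function.update
        (Function.update σ.ivar 11 x) 7 j) 11 y) 7 (j + 1) =
        Function.update (Function.update σ.ivar 11 y) 7 (j + 1) := by
      intro x y
      funext v
      by_cases h1 : v = 7 <;> by_cases h2 : v = 11 <;> simp [h1, h2]
    have up' : ∀ x : ℕ, Function.update (Function.update
        (Function.update σ.ivar 11 x) 7 j) 7 (j + 1) =
        Function.update (Function.update σ.ivar 11 x) 7 (j + 1) := by
      intro x
      simp
    simp only [Program.exec]
    rw [hcard]
    split_ifs with h1 h2 h3 h4 h5 h6 <;>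
      first
      | (exfalso; tauto)
      | (simp [State.seti, IExpr.eval, up, add_assoc])
  · rintro σ' rfl
    exact ⟨by simp [State.seti], fun v h1 h2 => by simp [State.seti, h1, h2], rfl, rfl, rfl⟩

/-- Compute the number of points, the size of the tree and the parents. -/
def sizeProg : Program :=
  (.iset 1 (.add (.var 0) (.const 1)) ;; .iset 12 (.add (.var 1) (.const 1)) ;;
    .iset 2 (.const 1)) ;;
  .loop (.ilt (.var 2) (.var 12)) (.iset 2 (.add (.var 2) (.var 2))) ;;
  .iset 3 (.const 1) ;;
  forLoop 3 2 (.iwrite 6 (.add (.var 3) (.var 3)) (.var 3) ;;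
    .iwrite 6 (.add (.add (.var 3) (.var 3)) (.const 1)) (.var 3))

/-- Doubling happens only below `n + 2`, which keeps the size below `2 * (n + 2)`. Each doubling
adds at least `1`, so linear fuel is enough. Parents are tabulated because integers cannot be
divided. -/
theorem sizeProg_halts {n : ℕ} {σ : State} (h0 : σ.ivar 0 = n) (h6 : ∀ v, σ.iarr 6 v = 0) :
    Halts sizeProg σ (100 * (n + 2)) (fun σ' => σ'.ivar 1 = n + 1 ∧ σ'.ivar 12 = n + 2 ∧
      ∃ k, σ'.ivar 2 = 2 ^ k ∧ n + 1 < 2 ^ k ∧ 2 ^ k < 2 * (n + 2) ∧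
        ∀ v, v < 2 * 2 ^ k → σ'.iarr 6 v = v / 2) := by
  refine Halts.seq (T := 20) (T' := ((n + 1) * (4 + 3) + 3) + (2 + (2 * (n + 2) * (20 + 7) + 3)))
    (Halts.exec rfl (by decide) rfl) ?_ (by omega)
  rintro σ₁ rfl
  refine Halts.seq (T := (n + 1) * (4 + 3) + 3) (T' := 2 + (2 * (n + 2) * (20 + 7) + 3))
    (Halts.whileLoop (T := 4) (c := 3) (j := n + 1)
    (fun j σ' => σ'.ivar 1 = n + 1 ∧ σ'.ivar 12 = n + 2 ∧ σ'.iarr = σ.iarr ∧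
      ∃ k, σ'.ivar 2 = 2 ^ k ∧ 2 ^ k < 2 * (n + 2) ∧ n + 2 ≤ 2 ^ k + j) le_rfl ?_ ?_) ?_ le_rfl
  · rintro j σ' ⟨h1, h12, hi, k, h2, hk, hj⟩ hb
    have hlt : 2 ^ k < n + 2 := by simpa [Test.Holds, IExpr.eval, h2, h12] using hb
    have hpos : 1 ≤ 2 ^ k := Nat.one_le_two_pow
    refine ⟨j - 1, by omega, Halts.exec rfl le_rfl ⟨?_, ?_, hi, k + 1, ?_, ?_, ?_⟩⟩
    · simp [Program.exec, h1]
    · simp [Program.exec, h12]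
    · simp [Program.exec, IExpr.eval, h2, pow_succ, mul_two]
    · rw [pow_succ]; omega
    · rw [pow_succ]; omega
  · refine ⟨?_, ?_, rfl, 0, ?_, by rw [pow_zero]; omega, by omega⟩ <;>
      simp [Program.exec, IExpr.eval, h0]
  · rintro σ₂ ⟨j, ⟨h1, h12, hi, k, h2, hk, -⟩, hb⟩
    have hge : n + 2 ≤ 2 ^ k := by simpa [Test.Holds, IExpr.eval, h2, h12] using hb
    refine Halts.seq (T := 2) (Halts.exec rfl le_rfl rfl) ?_ le_rfl
    rintro σ₃ rfl
    refine Halts.mono (Halts.forLoop (lo := 1) (hi := 2 ^ k) (T := 20)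
      (fun j σ' => σ'.ivar 1 = n + 1 ∧ σ'.ivar 12 = n + 2 ∧ σ'.ivar 2 = 2 ^ k ∧
        ∀ v, v < 2 * j → σ'.iarr 6 v = v / 2) (by decide) (by decide) (by decide) ?_ ?_
      Nat.one_le_two_pow ⟨?_, ?_, ?_, ?_⟩ ?_ le_rfl) ?_ ?_
    · simp [Program.exec, IExpr.eval]
    · simpa [Program.exec] using h2
    · simpa [Program.exec] using h1
    · simpa [Program.exec] using h12
    · simpa [Program.exec] using h2
    · intro v hv
      change σ₂.iarr 6 v = _
      rw [hi, h6]
      omega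
    · rintro j σ' hj - h3 - ⟨h1, h12, h2, hp⟩
      refine Halts.exec rfl (by decide) ⟨?_, ?_, ?_, fun v hv => ?_⟩
      · simpa [Program.exec, State.seti] using h1
      · simpa [Program.exec, State.seti] using h12
      · simpa [Program.exec, State.seti] using h2
      · have : ∀ v, (Program.exec (.iwrite 6 (.add (.var 3) (.var 3)) (.var 3) ;;
            .iwrite 6 (.add (.add (.var 3) (.var 3)) (.const 1)) (.var 3)) σ').iarr 6 v =
            if v = j + j + 1 then j else if v = j + j then j else σ'.iarr 6 v := by
          intro v
          simp [Program.exec, IExpr.eval, h3, Function.update_apply]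
        rw [State.seti_iarr, this]
        split_ifs
        · omega
        · omega
        · exact hp v (by omega)
    · have : 2 ^ k - 1 ≤ 2 * (n + 2) := by omega
      have := Nat.mul_le_mul_right (20 + 7) this
      omega
    · rintro σ' ⟨h1, h12, h2, hp⟩
      exact ⟨h1, h12, k, h2, by omega, hk, hp⟩

/-- Lexicographic order by `X`, then `Y`. -/
def LexLt (X Y : ℕ → ℝ) (j i : ℕ) : Prop := X j < X i ∨ (X j = X i ∧ Y j < Y i)

/-- Sort the points lexicographically. -/
def sortProg : Program :=
  .iset 10 (.const 0) ;;
  forLoop 10 0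
    ((.iset 11 (.const 1) ;; .iset 7 (.const 0)) ;;
      countProg 0 (.rlt (.read 0 (.var 7)) (.read 0 (.var 10)))
        (.req (.read 0 (.var 7)) (.read 0 (.var 10)))
        (.rlt (.read 1 (.var 7)) (.read 1 (.var 10))) ;;
      (.iwrite 1 (.var 11) (.add (.read 0 (.var 10)) (.const 1)) ;;
        .rwrite 5 (.var 11) (.sub (.const 1) (.read 2 (.var 10))) ;;
        .rwrite 4 (.var 11) (.read 1 (.var 10))))

-- The counter starts at `1` to reserve index `0` for the dummy, and colors are shifted by one to
-- keep color `0` for it. By `hinj` no later point overwrites an earlier one.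
open Classical in
theorem sortProg_halts {n : ℕ} {σ : State} (h0 : σ.ivar 0 = n)
    (hinj : ∀ i j, i < n → j < n →
      rank n (LexLt (σ.rarr 0) (σ.rarr 1)) i = rank n (LexLt (σ.rarr 0) (σ.rarr 1)) j → i = j) :
    Halts sortProg σ (200 * (n + 1) * (n + 1)) (fun σ' => σ'.iarr 1 0 = σ.iarr 1 0 ∧
      ∀ i, i < n → ∀ q, q = 1 + rank n (LexLt (σ.rarr 0) (σ.rarr 1)) i →
        σ'.iarr 1 q = σ.iarr 0 i + 1 ∧ σ'.rarr 5 q = 1 - σ.rarr 2 i ∧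
        σ'.rarr 4 q = σ.rarr 1 i) := by
  refine Halts.seq (T := 2) (T' := n * ((60 * n + 50) + 7) + 3) (Halts.exec rfl le_rfl rfl) ?_
    (by nlinarith)
  rintro σ₁ rfl
  refine Halts.mono (Halts.forLoop (lo := 0) (hi := n) (T := 60 * n + 50)
    (fun i σ' => σ'.iarr 0 = σ.iarr 0 ∧ σ'.rarr 0 = σ.rarr 0 ∧ σ'.rarr 1 = σ.rarr 1 ∧
      σ'.rarr 2 = σ.rarr 2 ∧ σ'.iarr 1 0 = σ.iarr 1 0 ∧
      ∀ i', i' < i → ∀ q, q = 1 + rank n (LexLt (σ.rarr 0) (σ.rarr 1)) i' →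
        σ'.iarr 1 q = σ.iarr 0 i' + 1 ∧ σ'.rarr 5 q = 1 - σ.rarr 2 i' ∧
        σ'.rarr 4 q = σ.rarr 1 i') (by decide) (by decide) (by decide) ?_ ?_ (Nat.zero_le _)
    ⟨rfl, rfl, rfl, rfl, rfl, fun i' h => by omega⟩ ?_ le_rfl) (by simp)
    (fun σ' h => h.2.2.2.2)
  · simp [Program.exec, IExpr.eval]
  · simpa [Program.exec] using h0
  · rintro i σ' - hi h10 h0 ⟨hi0, hr0, hr1, hr2, h10', hl⟩
    refine Halts.seq (T := 4) (T' := (60 * n + 3) + 20) (Halts.exec rfl le_rfl rfl) ?_ (by omega)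
    rintro σ₂ rfl
    refine Halts.seq (countProg_halts (lo := 0) (hi := n) (c := 1)
      (fun j => LexLt (σ.rarr 0) (σ.rarr 1) j i) (by decide) ?_ ?_ ?_ (Nat.zero_le _) (by decide)
      ?_) ?_ le_rfl
    · simp [Program.exec, IExpr.eval]
    · simp [Program.exec, IExpr.eval]
    · simpa [Program.exec] using h0
    · intro j c _ _
      simp [Program.exec, IExpr.eval, RExpr.eval, Test.Holds, State.seti, LexLt, h10, hr0, hr1]
    · rintro σ₃ ⟨h11, hv, hrv, hia, hra⟩
      have h11' : σ₃.ivar 11 = 1 + rank n (LexLt (σ.rarr 0) (σ.rarr 1)) i := by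
        rw [h11, rank, Finset.range_eq_Ico]
      have h10'' : σ₃.ivar 10 = i := by rw [hv 10 (by decide) (by decide)]; simpa [Program.exec]
      set c := 1 + rank n (LexLt (σ.rarr 0) (σ.rarr 1)) i with hc
      have ia : σ₃.iarr = σ'.iarr := hia
      have ra : σ₃.rarr = σ'.rarr := hra
      refine Halts.exec rfl (by decide) ⟨?_, ?_, ?_, ?_, ?_, ?_⟩
      · simp [Program.exec, ia, hi0]
      · simp [Program.exec, ra, hr0]
      · simp [Program.exec, ra, hr1]
      · simp [Program.exec, ra, hr2]
      · have : (0 : ℕ) ≠ c := by omega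
        simp [Program.exec, IExpr.eval, h11', ia, h10', this]
      · intro i' hi' q hq
        by_cases hii : i' = i
        · have hqc : q = c := by rw [hq, hii]
          subst hii
          subst hqc
          simp [Program.exec, IExpr.eval, RExpr.eval, h11', h10'', ia, ra, hi0, hr1, hr2]
        · have hqc : q ≠ c := by
            rw [hq, hc]
            intro e
            exact hii (hinj i' i (by omega) hi (by omega))
          have := hl i' (by omega) q hq
          simp [Program.exec, IExpr.eval, RExpr.eval, h11', ia, ra, hqc, this]

/-- Order by height `y`, then index, with `0` on top. -/
def HeightLt (y : ℕ → ℝ) (j q : ℕ) : Prop :=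
  j ≠ 0 ∧ (q = 0 ∨ y j < y q ∨ (y j = y q ∧ j < q))

theorem HeightLt.irrefl (y : ℕ → ℝ) (i : ℕ) : ¬ HeightLt y i i := by
  rintro ⟨h, h1 | h1 | h1⟩
  · exact h h1
  · exact lt_irrefl _ h1
  · exact lt_irrefl _ h1.2

theorem HeightLt.trans (y : ℕ → ℝ) (i j k : ℕ) (h : HeightLt y i j) (h' : HeightLt y j k) :
    HeightLt y i k := by
  obtain ⟨h0, h1⟩ := h
  obtain ⟨h0', h1'⟩ := h'
  refine ⟨h0, h1'.imp_right fun h2 => ?_⟩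
  rcases h1 with h1 | h1 | h1
  · exact absurd h1 h0'
  · rcases h2 with h2 | h2
    · exact Or.inl (h1.trans h2)
    · exact Or.inl (h2.1 ▸ h1)
  · rcases h2 with h2 | h2
    · exact Or.inl (h1.1 ▸ h2)
    · exact Or.inr ⟨h1.1.trans h2.1, h1.2.trans h2.2⟩

theorem HeightLt.total (y : ℕ → ℝ) (i j : ℕ) (h : i ≠ j) : HeightLt y i j ∨ HeightLt y j i := by
  unfold HeightLt
  rcases eq_or_ne i 0 with rfl | hi
  · exact Or.inr ⟨h.symm, Or.inl rfl⟩
  rcases eq_or_ne j 0 with rfl | hj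
  · exact Or.inl ⟨hi, Or.inl rfl⟩
  rcases lt_trichotomy (y i) (y j) with h1 | h1 | h1
  · exact Or.inl ⟨hi, Or.inr (Or.inl h1)⟩
  · rcases Nat.lt_or_gt_of_ne h with h2 | h2
    · exact Or.inl ⟨hi, Or.inr (Or.inr ⟨h1, h2⟩)⟩
    · exact Or.inr ⟨hj, Or.inr (Or.inr ⟨h1.symm, h2⟩)⟩
  · exact Or.inr ⟨hj, Or.inr (Or.inl h1)⟩

open Classical in
theorem rank_heightLt_zero (y : ℕ → ℝ) (n : ℕ) : rank (n + 1) (HeightLt y) 0 = n := by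
  have : (Finset.range (n + 1)).filter (fun j => HeightLt y j 0) = Finset.Ico 1 (n + 1) := by
    ext j
    simp [HeightLt]
    omega
  rw [rank, this, Nat.card_Ico]
  omega

-- The dummy precedes nothing, so the count can start at `1`.
open Classical in
theorem rank_heightLt (y : ℕ → ℝ) (n : ℕ) {q : ℕ} (hq : 1 ≤ q) :
    rank (n + 1) (HeightLt y) q =
      ((Finset.Ico 1 (n + 1)).filter fun j => y j < y q ∨ (y j = y q ∧ j < q)).card := by
  have h : q ≠ 0 := by omega
  rw [rank]
  congr 1
  ext j
  simp only [Finset.mem_filter, Finset.mem_range, Finset.mem_Ico, HeightLt, h, false_or]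
  constructor
  · rintro ⟨h1, h2, h3⟩
    exact ⟨⟨by omega, h1⟩, h3⟩
  · rintro ⟨⟨h1, h2⟩, h3⟩
    exact ⟨h2, by omega, h3⟩

open Classical in
theorem rank_heightLt_inj (y : ℕ → ℝ) {K i j : ℕ} (hi : i < K) (hj : j < K)
    (h : rank K (HeightLt y) i = rank K (HeightLt y) j) : i = j :=
  rank_inj (HeightLt.irrefl y) (HeightLt.trans y) (fun i j _ _ h => HeightLt.total y i j h) hi hj h

/-- Sort the points by height. -/
def heightProg : Program :=
  .iset 10 (.const 1) ;;
  forLoop 10 1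
    ((.iset 11 (.const 0) ;; .iset 7 (.const 1)) ;;
      countProg 1 (.rlt (.read 4 (.var 7)) (.read 4 (.var 10)))
        (.req (.read 4 (.var 7)) (.read 4 (.var 10)))
        (.ilt (.var 7) (.var 10)) ;;
      (.iwrite 2 (.var 10) (.var 11) ;; .iwrite 3 (.var 11) (.var 10))) ;;
  .iwrite 2 (.const 0) (.var 0)

open Classical in
theorem heightProg_halts {n : ℕ} {σ : State} (h0 : σ.ivar 0 = n) (h1 : σ.ivar 1 = n + 1)
    (h3 : ∀ b, σ.iarr 3 b = 0) :
    Halts heightProg σ (200 * (n + 1) * (n + 1)) (fun σ' =>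
      (∀ q, q < n + 1 → σ'.iarr 2 q = rank (n + 1) (HeightLt (σ.rarr 4)) q ∧
        σ'.iarr 3 (rank (n + 1) (HeightLt (σ.rarr 4)) q) = q) ∧ σ'.iarr 3 (n + 1) = 0) := by
  refine Halts.seq (T := 2) (T' := ((n + 1 - 1) * ((60 * (n + 1) + 50) + 7) + 3) + 5)
    (Halts.exec rfl le_rfl rfl) ?_ (by simp; nlinarith)
  rintro σ₁ rfl
  refine Halts.seq (Halts.forLoop (lo := 1) (hi := n + 1) (T := 60 * (n + 1) + 50)
    (fun i σ' => σ'.ivar 0 = n ∧ σ'.rarr 4 = σ.rarr 4 ∧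
      (∀ q, 1 ≤ q → q < i → σ'.iarr 2 q = rank (n + 1) (HeightLt (σ.rarr 4)) q ∧
        σ'.iarr 3 (rank (n + 1) (HeightLt (σ.rarr 4)) q) = q) ∧
      ∀ b, (∀ q, 1 ≤ q → q < i → b ≠ rank (n + 1) (HeightLt (σ.rarr 4)) q) → σ'.iarr 3 b = 0)
    (by decide) (by decide) (by decide) ?_ ?_ (by omega)
    ⟨?_, rfl, fun q h1 h2 => by omega, fun b _ => h3 b⟩ ?_ le_rfl) ?_ le_rfl
  · simp [Program.exec, IExpr.eval]
  · simpa [Program.exec] using h1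
  · simpa [Program.exec] using h0
  · rintro q σ' hq1 hq h10 h1 ⟨h0, hy, hl, hz⟩
    refine Halts.seq (T := 4) (T' := (60 * (n + 1) + 3) + 20) (Halts.exec rfl le_rfl rfl) ?_
      (by omega)
    rintro σ₂ rfl
    refine Halts.seq (countProg_halts (lo := 1) (hi := n + 1) (c := 0)
      (fun j => σ.rarr 4 j < σ.rarr 4 q ∨ (σ.rarr 4 j = σ.rarr 4 q ∧ j < q))
      (by decide) ?_ ?_ ?_ (by omega) (by decide) ?_) ?_ le_rfl
    · simp [Program.exec, IExpr.eval]
    · simp [Program.exec, IExpr.eval]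
    · simpa [Program.exec] using h1
    · intro j c _ _
      simp [Program.exec, IExpr.eval, RExpr.eval, Test.Holds, State.seti, h10, hy]
    · rintro σ₃ ⟨h11, hv, hrv, hia, hra⟩
      replace h11 : σ₃.ivar 11 = rank (n + 1) (HeightLt (σ.rarr 4)) q := by
        rw [h11, zero_add, rank_heightLt _ _ hq1]
        congr!
      have h10' : σ₃.ivar 10 = q := by rw [hv 10 (by decide) (by decide)]; simpa [Program.exec]
      have h0' : σ₃.ivar 0 = n := by rw [hv 0 (by decide) (by decide)]; simpa [Program.exec]
      set c := rank (n + 1) (HeightLt (σ.rarr 4)) q with hc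
      have ia : σ₃.iarr = σ'.iarr := hia
      have ra : σ₃.rarr = σ'.rarr := hra
      have e2 : (Program.exec (.iwrite 2 (.var 10) (.var 11) ;; .iwrite 3 (.var 11) (.var 10))
          σ₃).iarr 2 = Function.update (σ'.iarr 2) q c := by
        simp [Program.exec, IExpr.eval, h11, h10', ia]
      have e3 : (Program.exec (.iwrite 2 (.var 10) (.var 11) ;; .iwrite 3 (.var 11) (.var 10))
          σ₃).iarr 3 = Function.update (σ'.iarr 3) c q := by
        simp [Program.exec, IExpr.eval, h11, h10', ia]
      refine Halts.exec rfl (by decide) ⟨?_, ?_, fun q' hq1' hq' => ?_, fun b hb => ?_⟩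
      · simpa [Program.exec, State.seti] using h0'
      · simp [Program.exec, ra, hy]
      · rw [State.seti_iarr, e2, e3]
        rcases eq_or_ne q' q with rfl | hne
        · simp [hc]
        · have : rank (n + 1) (HeightLt (σ.rarr 4)) q' ≠ c := fun e =>
            hne (rank_heightLt_inj _ (by omega) hq e)
          rw [Function.update_of_ne hne, Function.update_of_ne this]
          exact hl q' hq1' (by omega)
      · rw [State.seti_iarr, e3, Function.update_of_ne (hb q hq1 (by omega))]
        exact hz b fun q' h1 h2 => hb q' h1 (by omega)
  · rintro σ₂ ⟨h0, hy, hl, hz⟩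
    refine Halts.exec rfl (by decide) ⟨fun q hq => ?_, ?_⟩
    · rcases eq_or_ne q 0 with rfl | hne
      · rw [rank_heightLt_zero]
        refine ⟨by simp [Program.exec, IExpr.eval, h0], ?_⟩
        -- Entry `n` is never written: rank `n` belongs to the dummy, and the default `0` is its
        -- index.
        rw [← hz n fun q h1 h2 e => ?_]
        · simp [Program.exec]
        · have := rank_heightLt_inj (σ.rarr 4) (K := n + 1) (i := 0) (by omega) h2
            (by rw [← e, rank_heightLt_zero])
          omega
      · have := hl q (by omega) hq
        refine ⟨?_, ?_⟩
        · rw [← this.1]; simp [Program.exec, IExpr.eval, hne]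
        · rw [← this.2]; simp [Program.exec, IExpr.eval, this.2]
    · rw [← hz (n + 1) fun q h1 h2 => ?_]
      · simp [Program.exec]
      · have := rank_lt (lt := HeightLt (σ.rarr 4)) (HeightLt.irrefl _) h2
        omega

/-- Order by color, then index. -/
def ColorLt (col : ℕ → ℕ) (j q : ℕ) : Prop := col j < col q ∨ (col j = col q ∧ j < q)

/-- Sort the points by color. -/
def posProg : Program :=
  .iset 10 (.const 0) ;;
  forLoop 10 1
    ((.iset 11 (.const 0) ;; .iset 7 (.const 0)) ;;
      countProg 1 (.ilt (.read 1 (.var 7)) (.read 1 (.var 10)))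
        (.ieq (.read 1 (.var 7)) (.read 1 (.var 10)))
        (.ilt (.var 7) (.var 10)) ;;
      .iwrite 4 (.var 10) (.var 11))

open Classical in
theorem posProg_halts {K : ℕ} {σ : State} (h1 : σ.ivar 1 = K) :
    Halts posProg σ (200 * (K + 1) * (K + 1)) (fun σ' =>
      ∀ q, q < K → σ'.iarr 4 q = rank K (ColorLt (σ.iarr 1)) q) := by
  refine Halts.seq (T := 2) (T' := (K - 0) * ((60 * K + 50) + 7) + 3)
    (Halts.exec rfl le_rfl rfl) ?_ (by simp; nlinarith)
  rintro σ₁ rfl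
  refine Halts.mono (Halts.forLoop (lo := 0) (hi := K) (T := 60 * K + 50)
    (fun i σ' => σ'.iarr 1 = σ.iarr 1 ∧
      ∀ q, q < i → σ'.iarr 4 q = rank K (ColorLt (σ.iarr 1)) q)
    (by decide) (by decide) (by decide) ?_ ?_ (by omega)
    ⟨rfl, fun q h2 => by omega⟩ ?_ le_rfl) le_rfl (fun σ' h => h.2)
  · simp [Program.exec, IExpr.eval]
  · simpa [Program.exec] using h1
  · rintro q σ' - hq h10 h1 ⟨hc1, hl⟩
    refine Halts.seq (T := 4) (T' := (60 * K + 3) + 20) (Halts.exec rfl le_rfl rfl) ?_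
      (by omega)
    rintro σ₂ rfl
    refine Halts.seq (countProg_halts (lo := 0) (hi := K) (c := 0)
      (fun j => ColorLt (σ.iarr 1) j q)
      (by decide) ?_ ?_ ?_ (by omega) (by decide) ?_) ?_ le_rfl
    · simp [Program.exec, IExpr.eval]
    · simp [Program.exec, IExpr.eval]
    · simpa [Program.exec] using h1
    · intro j c _ _
      simp [Program.exec, IExpr.eval, Test.Holds, State.seti, h10, hc1, ColorLt]
    · rintro σ₃ ⟨h11, hv, hrv, hia, hra⟩
      have h11' : σ₃.ivar 11 = rank K (ColorLt (σ.iarr 1)) q := by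
        rw [h11, rank, Finset.range_eq_Ico, zero_add]
      have h10' : σ₃.ivar 10 = q := by rw [hv 10 (by decide) (by decide)]; simpa [Program.exec]
      have ia : σ₃.iarr = σ'.iarr := hia
      refine Halts.exec rfl (by decide) ⟨?_, fun q' hq' => ?_⟩
      · simp [Program.exec, ia, hc1]
      · have e4 : (Program.exec (.iwrite 4 (.var 10) (.var 11)) σ₃).iarr 4 =
            Function.update (σ'.iarr 4) q (rank K (ColorLt (σ.iarr 1)) q) := by
          simp [Program.exec, IExpr.eval, h11', h10', ia]
        rw [State.seti_iarr, e4]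
        rcases eq_or_ne q' q with rfl | hne
        · simp
        · rw [Function.update_of_ne hne]
          exact hl q' (by omega)

/-- Compute the products over the gaps between points of equal color. -/
def gapProg : Program :=
  .iset 10 (.const 0) ;;
  forLoop 10 1
    ((.rset 3 (.const 0) ;; .iset 7 (.const 0)) ;;
      forLoop 7 10 (.branch (.ieq (.read 1 (.var 7)) (.read 1 (.var 10))) (.rset 3 (.const 1))
        (.rset 3 (.mul (.var 3) (.read 5 (.var 7))))) ;;
      .rwrite 6 (.var 10) (.var 3))

theorem gapProg_halts {K : ℕ} {σ : State} (h1 : σ.ivar 1 = K) :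
    Halts gapProg σ (200 * (K + 1) * (K + 1)) (fun σ' =>
      ∀ q, q < K → σ'.rarr 6 q = gap (σ.rarr 5) (σ.iarr 1) (σ.iarr 1 q) q) := by
  refine Halts.seq (T := 2) (T' := (K - 0) * ((60 * K + 50) + 7) + 3)
    (Halts.exec rfl le_rfl rfl) ?_ (by simp; nlinarith)
  rintro σ₁ rfl
  refine Halts.mono (Halts.forLoop (lo := 0) (hi := K) (T := 60 * K + 50)
    (fun i σ' => σ'.iarr 1 = σ.iarr 1 ∧ σ'.rarr 5 = σ.rarr 5 ∧
      ∀ q, q < i → σ'.rarr 6 q = gap (σ.rarr 5) (σ.iarr 1) (σ.iarr 1 q) q)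
    (by decide) (by decide) (by decide) ?_ ?_ (by omega)
    ⟨rfl, rfl, fun q h2 => by omega⟩ ?_ le_rfl) le_rfl (fun σ' h => h.2.2)
  · simp [Program.exec, IExpr.eval]
  · simpa [Program.exec] using h1
  · rintro q σ' - hq h10 h1 ⟨hc, hα, hl⟩
    refine Halts.seq (T := 4) (T' := ((q - 0) * (20 + 7) + 3) + 20) (Halts.exec rfl le_rfl rfl) ?_
      (by omega)
    rintro σ₂ rfl
    refine Halts.seq (Halts.forLoop (lo := 0) (hi := q) (T := 20)
      (fun j σ'' => σ''.ivar 10 = q ∧ σ''.iarr = σ'.iarr ∧ σ''.rarr = σ'.rarr ∧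
        σ''.rvar 3 = gap (σ.rarr 5) (σ.iarr 1) (σ.iarr 1 q) j)
      (by decide) (by decide) (by decide) ?_ ?_ (Nat.zero_le _) ⟨?_, rfl, rfl, ?_⟩ ?_ le_rfl) ?_
      le_rfl
    · simp [Program.exec, IExpr.eval]
    · simpa [Program.exec] using h10
    · simpa [Program.exec] using h10
    · simp [Program.exec, RExpr.eval, gap]
    · rintro j σ'' - - h7 - ⟨h10, hia, hra, h3⟩
      refine Halts.exec rfl (by decide) ?_
      by_cases hcc : σ.iarr 1 j = σ.iarr 1 q <;>
      simp [Program.exec, IExpr.eval, RExpr.eval, Test.Holds, State.seti, h7, h10, hia, hra, h3,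
        hc, hα, gap, hcc]
    · rintro σ₃ ⟨h10', hia, hra, h3⟩
      refine Halts.exec rfl (by decide) ⟨?_, ?_, fun q' hq' => ?_⟩
      · simp [Program.exec, hia, hc]
      · simp [Program.exec, hra, hα]
      · have e6 : (Program.exec (.rwrite 6 (.var 10) (.var 3)) σ₃).rarr 6 =
            Function.update (σ'.rarr 6) q (gap (σ.rarr 5) (σ.iarr 1) (σ.iarr 1 q) q) := by
          simp [Program.exec, IExpr.eval, RExpr.eval, h10', hra, h3]
        rw [State.seti_rarr, e6]
        rcases eq_or_ne q' q with rfl | hne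
        · simp
        · rw [Function.update_of_ne hne]
          exact hl q' (by omega)

/-- Compute the row offsets. -/
def offsetProg : Program :=
  .iset 10 (.const 0) ;;
  forLoop 10 1 (.iwrite 5 (.add (.var 10) (.const 1)) (.add (.read 5 (.var 10)) (.var 1)))

/-- Integers cannot be multiplied, so the multiples of `K` are accumulated by addition. -/
theorem offsetProg_halts {K : ℕ} {σ : State} (h1 : σ.ivar 1 = K) (h5 : σ.iarr 5 0 = 0) :
    Halts offsetProg σ (200 * (K + 1)) (fun σ' => ∀ b, b ≤ K → σ'.iarr 5 b = b * K) := by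
  refine Halts.seq (T := 2) (T' := (K - 0) * (20 + 7) + 3) (Halts.exec rfl le_rfl rfl) ?_
    (by omega)
  rintro σ₁ rfl
  refine Halts.mono (Halts.forLoop (lo := 0) (hi := K) (T := 20)
    (fun i σ' => ∀ b, b ≤ i → σ'.iarr 5 b = b * K)
    (by decide) (by decide) (by decide) ?_ ?_ (by omega) ?_ ?_ le_rfl) le_rfl (fun σ' h => h)
  · simp [Program.exec, IExpr.eval]
  · simpa [Program.exec] using h1
  · intro b hb
    obtain rfl : b = 0 := by omega
    simpa [Program.exec] using h5
  · rintro i σ' - hi h10 h1 hl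
    refine Halts.exec rfl (by decide) fun b hb => ?_
    have e5 : (Program.exec (.iwrite 5 (.add (.var 10) (.const 1))
        (.add (.read 5 (.var 10)) (.var 1))) σ').iarr 5 =
          Function.update (σ'.iarr 5) (i + 1) (i * K + K) := by
      simp [Program.exec, IExpr.eval, h10, h1, hl i le_rfl]
    rw [State.seti_iarr, e5]
    rcases eq_or_ne b (i + 1) with rfl | hne
    · rw [Function.update_self, Nat.succ_mul]
    · rw [Function.update_of_ne hne]
      exact hl b (by omega)

theorem ColorLt.irrefl (c : ℕ → ℕ) (i : ℕ) : ¬ ColorLt c i i := by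
  unfold ColorLt; omega

theorem ColorLt.trans (c : ℕ → ℕ) (i j k : ℕ) (h : ColorLt c i j) (h' : ColorLt c j k) :
    ColorLt c i k := by
  unfold ColorLt at *; omega

theorem ColorLt.total (c : ℕ → ℕ) (i j : ℕ) (h : i ≠ j) : ColorLt c i j ∨ ColorLt c j i := by
  unfold ColorLt; omega

theorem LexLt.irrefl (X Y : ℕ → ℝ) (i : ℕ) : ¬ LexLt X Y i i := by
  rintro (h | h)
  · exact lt_irrefl _ h
  · exact lt_irrefl _ h.2

theorem LexLt.trans (X Y : ℕ → ℝ) (i j k : ℕ) (h : LexLt X Y i j) (h' : LexLt X Y j k) :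
    LexLt X Y i k := by
  rcases h with h | h <;> rcases h' with h' | h'
  · exact Or.inl (h.trans h')
  · exact Or.inl (h'.1 ▸ h)
  · exact Or.inl (h.1 ▸ h')
  · exact Or.inr ⟨h.1.trans h'.1, h.2.trans h'.2⟩

theorem LexLt.total (X Y : ℕ → ℝ) (i j : ℕ) (h : ¬ (X i = X j ∧ Y i = Y j)) :
    LexLt X Y i j ∨ LexLt X Y j i := by
  rcases lt_trichotomy (X i) (X j) with h1 | h1 | h1
  · exact Or.inl (Or.inl h1)
  · rcases lt_trichotomy (Y i) (Y j) with h2 | h2 | h2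
    · exact Or.inl (Or.inr ⟨h1, h2⟩)
    · exact absurd ⟨h1, h2⟩ h
    · exact Or.inr (Or.inr ⟨h1.symm, h2⟩)
  · exact Or.inr (Or.inl h1)

/-! ### The complete program -/

/-- Prepare the description of the points. -/
def prepareProg : Program :=
  sizeProg ;; sortProg ;; heightProg ;; posProg ;; gapProg ;; offsetProg

/-- The program which solves the problem. -/
def csdProg : Program := prepareProg ;; tableProg

-- Zero initial memory is essential here: it provides the color of the dummy, the first row offset,
-- the unwritten entries of the list by height, and the padding of the tree.
open Classical in
theorem prepareProg_halts {n : ℕ} {σ : State} (h0 : σ.ivar 0 = n)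
    (hinj : ∀ i j, i < n → j < n → i ≠ j →
      ¬ (σ.rarr 0 i = σ.rarr 0 j ∧ σ.rarr 1 i = σ.rarr 1 j))
    (hz : ∀ a, a ≠ 0 → ∀ i, σ.iarr a i = 0) (hr8 : ∀ i, σ.rarr 8 i = 0) :
    Halts prepareProg σ (1500 * (n + 2) * (n + 2)) (fun σ' =>
      ∃ k, 2 ^ k < 2 * (n + 2) ∧
        Describes (n + 1) k (2 ^ k) σ'.iarr (σ'.rarr 5) (σ'.rarr 6) ∧
        Mem (n + 1) (2 ^ k) σ'.iarr (σ'.rarr 5) (σ'.rarr 6) σ' ∧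
        Padded (n + 1) (2 ^ k) σ' ∧ σ'.iarr 1 0 = 0 ∧ σ'.iarr 2 0 = n ∧
        (∀ q, q < n + 1 → σ'.iarr 2 q = rank (n + 1) (HeightLt (σ'.rarr 4)) q) ∧
        ∀ i, i < n → ∀ q, q = 1 + rank n (LexLt (σ.rarr 0) (σ.rarr 1)) i →
          σ'.iarr 1 q = σ.iarr 0 i + 1 ∧ σ'.rarr 5 q = 1 - σ.rarr 2 i ∧
          σ'.rarr 4 q = σ.rarr 1 i) := by
  refine Halts.seq (sizeProg_halts h0 (hz 6 (by decide))).frame (T' := 200 * (n + 1) * (n + 1) +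
    (200 * (n + 1) * (n + 1) + (200 * (n + 1 + 1) * (n + 1 + 1) + (200 * (n + 1 + 1) * (n + 1 + 1) +
      200 * (n + 1 + 1))))) ?_ (by nlinarith)
  rintro σ₁ ⟨⟨h11, h112, k, h12, hk1, hk2, hp⟩, hF1⟩
  have hra1 : σ₁.rarr = σ.rarr := by
    funext a; exact hF1.rarr a (by simp [sizeProg, forLoop, Program.rarrs])
  refine Halts.seq (sortProg_halts (σ := σ₁) (n := n) (by rw [hF1.ivar 0 (by decide), h0])
    (fun i j hi hj => ?_)).frame ?_ le_rfl
  · rw [hra1]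
    by_contra hcon
    push Not at hcon
    rcases LexLt.total (σ.rarr 0) (σ.rarr 1) i j (hinj i j hi hj hcon.2) with h | h
    · have := rank_lt_rank (K := n) (LexLt.irrefl _ _) (LexLt.trans _ _) hi h
      omega
    · have := rank_lt_rank (K := n) (LexLt.irrefl _ _) (LexLt.trans _ _) hj h
      omega
  rw [hra1]
  rintro σ₂ ⟨⟨h210, h2⟩, hF2⟩
  refine Halts.seq (heightProg_halts (σ := σ₂) (n := n)
    (by rw [hF2.ivar 0 (by decide), hF1.ivar 0 (by decide), h0])
    (by rw [hF2.ivar 1 (by decide), h11])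
    (by rw [hF2.iarr 3 (by decide), hF1.iarr 3 (by decide)]; exact hz 3 (by decide))).frame
    ?_ le_rfl
  rintro σ₃ ⟨⟨h3, h3'⟩, hF3⟩
  refine Halts.seq (posProg_halts (σ := σ₃) (K := n + 1)
    (by rw [hF3.ivar 1 (by decide), hF2.ivar 1 (by decide), h11])).frame ?_ le_rfl
  rintro σ₄ ⟨h4, hF4⟩
  refine Halts.seq (gapProg_halts (σ := σ₄) (K := n + 1)
    (by rw [hF4.ivar 1 (by decide), hF3.ivar 1 (by decide), hF2.ivar 1 (by decide), h11])).frame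
    ?_ le_rfl
  rintro σ₅ ⟨h5, hF5⟩
  refine (offsetProg_halts (σ := σ₅) (K := n + 1)
    (by rw [hF5.ivar 1 (by decide), hF4.ivar 1 (by decide), hF3.ivar 1 (by decide),
      hF2.ivar 1 (by decide), h11])
    (by rw [hF5.iarr 5 (by decide), hF4.iarr 5 (by decide), hF3.iarr 5 (by decide),
      hF2.iarr 5 (by decide), hF1.iarr 5 (by decide)]; exact hz 5 (by decide) 0)).frame.mono
    le_rfl ?_
  rintro σ₆ ⟨h6, hF6⟩
  have i1 : σ₆.iarr 1 = σ₂.iarr 1 := by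
    rw [hF6.iarr 1 (by decide), hF5.iarr 1 (by decide), hF4.iarr 1 (by decide),
      hF3.iarr 1 (by decide)]
  have i2 : σ₆.iarr 2 = σ₃.iarr 2 := by
    rw [hF6.iarr 2 (by decide), hF5.iarr 2 (by decide), hF4.iarr 2 (by decide)]
  have i3 : σ₆.iarr 3 = σ₃.iarr 3 := by
    rw [hF6.iarr 3 (by decide), hF5.iarr 3 (by decide), hF4.iarr 3 (by decide)]
  have i4 : σ₆.iarr 4 = σ₄.iarr 4 := by
    rw [hF6.iarr 4 (by decide), hF5.iarr 4 (by decide)]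
  have i6 : σ₆.iarr 6 = σ₁.iarr 6 := by
    rw [hF6.iarr 6 (by decide), hF5.iarr 6 (by decide), hF4.iarr 6 (by decide),
      hF3.iarr 6 (by decide), hF2.iarr 6 (by decide)]
  have i31 : σ₃.iarr 1 = σ₂.iarr 1 := hF3.iarr 1 (by decide)
  have i41 : σ₄.iarr 1 = σ₂.iarr 1 := by rw [hF4.iarr 1 (by decide), i31]
  have r4 : σ₆.rarr 4 = σ₂.rarr 4 := by
    rw [hF6.rarr 4 (by decide), hF5.rarr 4 (by decide), hF4.rarr 4 (by decide),
      hF3.rarr 4 (by decide)]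
  have r5 : σ₆.rarr 5 = σ₂.rarr 5 := by
    rw [hF6.rarr 5 (by decide), hF5.rarr 5 (by decide), hF4.rarr 5 (by decide),
      hF3.rarr 5 (by decide)]
  have r54 : σ₄.rarr 5 = σ₂.rarr 5 := by
    rw [hF4.rarr 5 (by decide), hF3.rarr 5 (by decide)]
  have r6 : σ₆.rarr 6 = σ₅.rarr 6 := hF6.rarr 6 (by decide)
  have r8 : ∀ i, σ₆.rarr 8 i = 0 := by
    rw [hF6.rarr 8 (by decide), hF5.rarr 8 (by decide), hF4.rarr 8 (by decide),
      hF3.rarr 8 (by decide), hF2.rarr 8 (by decide), hra1]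
    exact hr8
  have v1 : σ₆.ivar 1 = n + 1 := by
    rw [hF6.ivar 1 (by decide), hF5.ivar 1 (by decide), hF4.ivar 1 (by decide),
      hF3.ivar 1 (by decide), hF2.ivar 1 (by decide), h11]
  have v2 : σ₆.ivar 2 = 2 ^ k := by
    rw [hF6.ivar 2 (by decide), hF5.ivar 2 (by decide), hF4.ivar 2 (by decide),
      hF3.ivar 2 (by decide), hF2.ivar 2 (by decide), h12]
  have v12 : σ₆.ivar 12 = n + 2 := by
    rw [hF6.ivar 12 (by decide), hF5.ivar 12 (by decide), hF4.ivar 12 (by decide),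
      hF3.ivar 12 (by decide), hF2.ivar 12 (by decide), h112]
  rw [i31] at h4
  rw [i41, r54] at h5
  set y := σ₂.rarr 4
  have pos := fun q hq => (i4 ▸ h4 q hq : σ₆.iarr 4 q = rank (n + 1) (ColorLt (σ₂.iarr 1)) q)
  have tot := fun (i j : ℕ) (_ : i < n + 1) (_ : j < n + 1) (h : i ≠ j) =>
    HeightLt.total y i j h
  have tot' := fun (i j : ℕ) (_ : i < n + 1) (_ : j < n + 1) (h : i ≠ j) =>
    ColorLt.total (σ₂.iarr 1) i j h
  refine ⟨k, hk2, ⟨rfl, hk1, by rw [i6]; exact hp, fun q hq => ?_, fun q hq => ?_, fun b hb => ?_,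
    fun b hb => ?_, ?_, fun q hq => ?_, fun i hi => ?_, fun q hq q' hq' => ?_, h6, fun q hq => ?_⟩,
    ⟨rfl, rfl, rfl, v1, v2, v12⟩, fun i _ _ => r8 _, ?_, ?_, fun q hq => ?_, ?_⟩
  · rw [i2, (h3 q hq).1]
    exact rank_lt (HeightLt.irrefl y) hq
  · rw [i2, i3, (h3 q hq).1, (h3 q hq).2]
  · obtain ⟨q, hq, rfl⟩ := exists_rank_eq (HeightLt.irrefl y) (HeightLt.trans y) tot hb
    rw [i3, (h3 q hq).2]
    exact hq
  · obtain ⟨q, hq, rfl⟩ := exists_rank_eq (HeightLt.irrefl y) (HeightLt.trans y) tot hb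
    rw [i3, (h3 q hq).2, i2, (h3 q hq).1]
  · rw [i3, h3']
  · rw [pos q hq]
    exact rank_lt (ColorLt.irrefl _) hq
  · obtain ⟨q, hq, rfl⟩ := exists_rank_eq (ColorLt.irrefl _) (ColorLt.trans _) tot' hi
    exact ⟨q, hq, pos q hq⟩
  · rw [pos q hq, pos q' hq', rank_lt_rank_iff (ColorLt.irrefl _) (ColorLt.trans _) tot' hq hq',
      ColorLt, i1]
  · rw [r6, h5 q hq, r5, i1]
  · rw [i1, h210, hF1.iarr 1 (by decide), hz 1 (by decide)]
  · rw [i2, (h3 0 (by omega)).1, rank_heightLt_zero]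
  · rw [i2, r4]
    exact (h3 q hq).1
  · intro i hi q hq
    have := h2 i hi q hq
    rw [hF1.iarr 0 (by decide)] at this
    rw [i1, r5, r4]
    exact this

-- A dominated point comes earlier in lexicographic order, even when abscissas agree. For a point
-- that comes earlier, comparing height ranks amounts to comparing ordinates, since ties are broken
-- by index. This yields `hdom`.
open Classical in
theorem csdProg_halts (S : Dataset 2) {n : ℕ} (a : Fin n ≃ S.points) :
    Halts csdProg (S.inputState a) (4000 * (n + 2) ^ 2 * (Nat.log 2 (n + 2) + 3))
      (fun σ' => σ'.rvar 0 = S.dominanceProb) := by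
  set σ := S.inputState a with hσ
  have h0 : σ.ivar 0 = n := by simp [hσ, Dataset.inputState]
  have hX : ∀ i : Fin n, σ.rarr 0 i = (a i).1 0 := fun i => by simp [hσ, Dataset.inputState]
  have hY : ∀ i : Fin n, σ.rarr 1 i = (a i).1 1 := fun i => by simp [hσ, Dataset.inputState]
  have hP : ∀ i : Fin n, σ.rarr 2 i = S.prob (a i) := fun i => by simp [hσ, Dataset.inputState]
  have hC : ∀ i : Fin n, σ.iarr 0 i = S.color (a i) := fun i => by simp [hσ, Dataset.inputState]
  have hinj : ∀ i j, i < n → j < n → i ≠ j →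
      ¬ (σ.rarr 0 i = σ.rarr 0 j ∧ σ.rarr 1 i = σ.rarr 1 j) := by
    rintro i j hi hj hne ⟨h1, h2⟩
    rw [hX ⟨i, hi⟩, hX ⟨j, hj⟩] at h1
    rw [hY ⟨i, hi⟩, hY ⟨j, hj⟩] at h2
    have : a ⟨i, hi⟩ = a ⟨j, hj⟩ := by
      apply Subtype.ext
      funext c
      fin_cases c
      · exact h1
      · exact h2
    have := a.injective this
    simp only [Fin.mk.injEq] at this
    exact hne this
  refine Halts.seq (T := 1500 * (n + 2) * (n + 2))
    (T' := 2000 * (n + 2) ^ 2 * (Nat.log 2 (n + 2) + 3)) (prepareProg_halts h0 hinj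
    (fun c hc i => by simp [hσ, Dataset.inputState, hc])
    (fun i => by simp [hσ, Dataset.inputState])) ?_ (by nlinarith)
  rintro σ' ⟨k, hk, D, hm, hpad, hc0, hr0, hr, hpt⟩
  set xr : ℕ → ℕ := rank n (LexLt (σ.rarr 0) (σ.rarr 1)) with hxr
  have hpt' : ∀ x : S.points, σ'.iarr 1 (1 + xr (a.symm x)) = S.color x + 1 ∧
      σ'.rarr 5 (1 + xr (a.symm x)) = 1 - S.prob x ∧
      σ'.rarr 4 (1 + xr (a.symm x)) = x.1 1 := by
    intro x
    have := hpt (a.symm x) (a.symm x).2 _ rfl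
    rwa [hC, hP, hY, a.apply_symm_apply] at this
  have tot := fun (i j : ℕ) (hi : i < n) (hj : j < n) (h : i ≠ j) =>
    LexLt.total (σ.rarr 0) (σ.rarr 1) i j (hinj i j hi hj h)
  have hxlt : ∀ i, i < n → xr i < n := fun i hi => rank_lt (LexLt.irrefl _ _) hi
  have hxl : ∀ x y : S.points, xr (a.symm x) < xr (a.symm y) ↔
      x.1 0 < y.1 0 ∨ (x.1 0 = y.1 0 ∧ x.1 1 < y.1 1) := by
    intro x y
    rw [hxr, rank_lt_rank_iff (LexLt.irrefl _ _) (LexLt.trans _ _) tot (a.symm x).2 (a.symm y).2,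
      LexLt, hX, hX, hY, hY, a.apply_symm_apply, a.apply_symm_apply]
  let φ : S.points ↪ ℕ := ⟨fun x => 1 + xr (a.symm x), fun x y h => by
    have := rank_inj (LexLt.irrefl _ _) (LexLt.trans _ _) tot (a.symm x).2 (a.symm y).2
      (Nat.add_left_cancel h)
    exact a.symm.injective (Fin.ext this)⟩
  have hφ : Finset.univ.map φ = Finset.Ico 1 (n + 1) := by
    apply Finset.eq_of_subset_of_card_le
    · intro q hq
      obtain ⟨x, -, rfl⟩ := Finset.mem_map.1 hq
      have := hxlt (a.symm x) (a.symm x).2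
      rw [Finset.mem_Ico]
      change 1 ≤ 1 + xr (a.symm x) ∧ 1 + xr (a.symm x) < n + 1
      omega
    · rw [Finset.card_map, Nat.card_Ico, Finset.card_univ, ← Fintype.card_congr a, Fintype.card_fin]
      omega
  have hmem : ∀ q, 1 ≤ q → q < n + 1 → ∃ x, φ x = q := by
    intro q h1 h2
    have : q ∈ Finset.univ.map φ := by rw [hφ]; simp [h1, h2]
    simpa using this
  have hφlt : ∀ x, φ x < n + 1 := fun x => by
    have := hxlt (a.symm x) (a.symm x).2
    change 1 + xr (a.symm x) < n + 1
    omega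
  have key := acceptAfter_eq_one_sub S (σ'.rarr 5) (σ'.iarr 1) (σ'.iarr 2) φ hφ
    (fun x => (hpt' x).2.1) (fun x => (hpt' x).1) hc0 hr0 (fun q h1 h2 => ?_) (fun x y => ?_)
  · have hK : n + 1 ≤ n + 2 := by omega
    -- This follows from `2 ^ k < 2 * (n + 2)`.
    have hlog : k ≤ Nat.log 2 (n + 2) + 1 := by
      rw [← Nat.log_mul_base (by norm_num) (by omega), mul_comm]
      exact Nat.le_log_of_pow_le (by norm_num) hk.le
    refine (tableProg_halts D hm (by omega) (fun q h1 h2 => ?_) hpad).mono ?_ fun σ'' h => ?_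
    · obtain ⟨x, rfl⟩ := hmem q h1 h2
      have : σ'.iarr 1 (φ x) = S.color x + 1 := (hpt' x).1
      omega
    · calc 1000 * (n + 1) * 2 ^ k * (k + 1)
          ≤ 1000 * (n + 2) * (2 * (n + 2)) * (Nat.log 2 (n + 2) + 3) :=
            Nat.mul_le_mul (Nat.mul_le_mul (Nat.mul_le_mul le_rfl hK) hk.le) (by omega)
        _ = _ := by ring
    · rw [h, key]
      ring
  · have h3 := D.rank_lt q (by omega)
    have h4 : σ'.iarr 2 q ≠ n := fun e => by
      have h5 := D.point_rank q (by omega)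
      have h6 := D.point_rank 0 (by omega)
      rw [e] at h5
      rw [hr0] at h6
      omega
    omega
  · have hyr : φ y < φ x → (σ'.iarr 2 (φ y) ≤ σ'.iarr 2 (φ x) ↔ y.1 1 ≤ x.1 1) := by
      intro hlt
      rw [← not_lt, hr _ (hφlt _), hr _ (hφlt _), rank_lt_rank_iff (HeightLt.irrefl _)
        (HeightLt.trans _) (fun i j _ _ h => HeightLt.total _ i j h) (hφlt _) (hφlt _), HeightLt]
      have e1 : σ'.rarr 4 (φ x) = x.1 1 := (hpt' x).2.2
      have e2 : σ'.rarr 4 (φ y) = y.1 1 := (hpt' y).2.2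
      have e3 : φ x ≠ 0 := by omega
      have e4 : φ y ≠ 0 := by change 1 + _ ≠ 0; omega
      have e5 : ¬ φ x < φ y := by omega
      rw [e1, e2]
      simp [e3, e4, e5]
    have hlt : φ y < φ x ↔ y.1 0 < x.1 0 ∨ (y.1 0 = x.1 0 ∧ y.1 1 < x.1 1) := by
      rw [← hxl]
      change 1 + _ < 1 + _ ↔ _
      omega
    rw [Dominates, Fin.forall_fin_two]
    constructor
    · rintro ⟨hne, h1, h2⟩
      have h3 : φ y < φ x := by
        rw [hlt]
        rcases h1.lt_or_eq with h1 | h1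
        · exact Or.inl h1
        · refine Or.inr ⟨h1, lt_of_le_of_ne h2 fun h => hne ?_⟩
          funext c
          fin_cases c
          · exact h1.symm
          · exact h.symm
      exact ⟨h3, (hyr h3).2 h2⟩
    · rintro ⟨h3, h4⟩
      refine ⟨fun h => ?_, ?_, (hyr h3).1 h4⟩
      · have : x = y := Subtype.ext h
        rw [this] at h3
        omega
      · rcases hlt.1 h3 with h | h
        · exact h.le
        · exact h.1.le

/-! ### The asymptotic bound -/

theorem isBigO_time :
    (fun n : ℕ => ((4000 * (n + 2) ^ 2 * (Nat.log 2 (n + 2) + 3) : ℕ) : ℝ)) =O[Filter.atTop]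
      (fun n : ℕ => (n : ℝ) ^ 2 * Real.log (n : ℝ) ^ 2) := by
  -- The time has only one logarithmic factor; the second is slack, available since `log n ≥ 1` for
  -- `n ≥ 3`. The estimates below give `4000 * 4 * 7 = 112000`, which is less than the constant
  -- chosen.
  refine Asymptotics.IsBigO.of_bound 200000 ?_
  filter_upwards [Filter.eventually_ge_atTop 3] with n hn
  have hn' : (3 : ℝ) ≤ n := by exact_mod_cast hn
  have hlog : 1 ≤ Real.log n := by
    rw [Real.le_log_iff_exp_le (by linarith)]
    exact Real.exp_one_lt_three.le.trans hn'
  have h1 : (Nat.log 2 (n + 2) : ℝ) ≤ 4 * Real.log n := by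
    have h2 : (Nat.log 2 (n + 2) : ℝ) * Real.log 2 ≤ Real.log (n + 2) := by
      rw [← Real.log_pow]
      apply Real.log_le_log (by positivity)
      exact_mod_cast Nat.pow_log_le_self 2 (by omega)
    have h3 : Real.log (n + 2) ≤ 2 * Real.log n := by
      have : (2 : ℝ) * Real.log n = Real.log ((n : ℝ) ^ 2) := by simp
      rw [this]
      apply Real.log_le_log (by linarith)
      nlinarith
    have h4 := Real.log_two_gt_d9
    have h5 : (0 : ℝ) ≤ Nat.log 2 (n + 2) := Nat.cast_nonneg _
    nlinarith
  rw [Real.norm_of_nonneg (by positivity), Real.norm_of_nonneg (by positivity)]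
  push_cast
  have h2 : (Nat.log 2 (n + 2) : ℝ) + 3 ≤ 7 * Real.log n ^ 2 := by nlinarith
  have h3 : ((n : ℝ) + 2) ^ 2 ≤ 4 * (n : ℝ) ^ 2 := by nlinarith
  calc 4000 * ((n : ℝ) + 2) ^ 2 * (Nat.log 2 (n + 2) + 3)
      ≤ 4000 * (4 * (n : ℝ) ^ 2) * (7 * Real.log n ^ 2) := by gcongr
    _ ≤ 200000 * ((n : ℝ) ^ 2 * Real.log n ^ 2) := by
      have : 0 ≤ (n : ℝ) ^ 2 * Real.log n ^ 2 := by positivity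
      nlinarith

end ColoredDominance

theorem mainTheorem2 :
    ∃ (P : RealRAM.Program) (T : ℕ → ℕ),
      ColoredDominance.SolvesPlanarCSD P T ∧
      (fun n : ℕ => (T n : ℝ)) =O[Filter.atTop]
        (fun n : ℕ => (n : ℝ) ^ 2 * Real.log (n : ℝ) ^ 2) := by
  refine ⟨ColoredDominance.csdProg, fun n => 4000 * (n + 2) ^ 2 * (Nat.log 2 (n + 2) + 3),
    fun S n a => ?_, ColoredDominance.isBigO_time⟩
  obtain ⟨t, σ, ht, hr, h⟩ := ColoredDominance.csdProg_halts S a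
  exact ⟨t, σ, ht, hr, h⟩
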